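/- Let $m>3$ and let $\vec a_1,\dots,\vec a_m\in\mathbb Z^2$ be nonzero vectors that span $\mathbb R^2$. For $b\in\mathbb T^m=(\mathbb R/\mathbb Z)^m$ consider the arrangement of the $m$ lines $H_i=\{x\in\mathbb T^2:\vec a_i\cdot x=b_i\}$ on $\mathbb T^2=\mathbb R^2/\mathbb Z^2$. We consider the arrangements without triple intersection (no three of the lines $H_i$ have a common point), and call two of them equivalent if one is obtained from the other by continuously translating the lines (moving $b$ along a path in $\mathbb T^m$) without creating a triple intersection at any time. Let $N$ be the number of equivalence classes. For $i<j<k$ such that $\vec a_i,\vec a_j,\vec a_k$ span $\mathbb R^2$, let $\vec n_{ijk}\in\mathbb Z^3$ be the cross product of the two columns of the $3\times 2$ matrix with rows $\vec a_i,\vec a_j,\vec a_k$, divided by the greatest common divisor of its entries, and let $\tilde n_{ijk}\in\mathbb Z^m$ have the entries of $\vec n_{ijk}$ at positions $i,j,k$ and zeros elsewhere. Choose $g,h$ such that $|\det(\vec a_g\mid\vec a_h)|$ is minimal among the nonzero values $|\det(\vec a_i\mid\vec a_j)|$, fix the lines $H_g,H_h$ at the origin ($b_g=b_h=0$), and let $\rho_{gh}:\mathbb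 Z^m\to\mathbb Z^{m-2}$ omit the $g$-th and $h$-th entries. Let $f$ be the number of $(m-2)$-flats of the arrangement in $\mathbb T^{m-2}$ of the hyperplanes $\{b:\rho_{gh}(\tilde n_I)\cdot b=0\}$, that is, the number of connected components of the complement of their union, where $I$ runs over the spanning triples. Put $$S=\sum_{\{I_1,\dots,I_{m-2}\}}\bigl|\det\bigl(\rho_{gh}(\tilde n_{I_1})\mid\cdots\mid\rho_{gh}(\tilde n_{I_{m-2}})\bigr)\bigr|,$$ the sum over all sets of $m-2$ distinct spanning triples, and let $e$ be the index in $\mathbb Z^2$ of the subgroup generated by $\vec a_1,\dots,\vec a_m$. Then $N$ and $f$ are finite, $N\le f\le S$, and $$N\le\frac{e}{|\det(\vec a_g\mid\vec a_h)|}\,f ,\qquad N\le\frac{e}{|\det(\vec a_g\mid\vec a_h)|}\,S .$$ In particular, if $\vec a_1,\dots,\vec a_m$ generate $\mathbb Z^2$, then $$N\le\frac{1}{|\det(\vec a_g\mid\vec a_h)|}\,f\qquad\text{and}\qquad N\le\frac{1}{|\det(\vec a_g\mid\vec a_h)|}\sum_{\{I_1,\dots,I_{m-2}\}}\bigl|\det\bigl(\rho_{gh}(\tilde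 n_{I_1})\mid\cdots\mid\rho_{gh}(\tilde n_{I_{m-2}})\bigr)\bigr| .$$ -/

import Mathlib

open scoped Classical Matrix

noncomputable section

/-! The torus `𝕋^κ` is `κ → UnitAddCircle`, that is `(ℝ/ℤ)^κ`. -/

/-- The affine toric hyperplane with normal vector `v` and intercept `c`: the points `x` of the
torus with `v · x = c` in `ℝ/ℤ`. For `κ = Fin 2` it is a line on `𝕋²`. -/
def toricHyperplane {κ : Type} [Fintype κ] (v : κ → ℤ) (c : UnitAddCircle) :
    Set (κ → UnitAddCircle) :=
  {x | ∑ l, v l • x l = c}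

/-- The top-dimensional flats (regions) of a toric arrangement with normal vectors `v` and
intercepts `c`: the connected components of the complement of the union of the hyperplanes. -/
abbrev TopFlats {ι κ : Type} [Fintype κ] (v : ι → κ → ℤ) (c : ι → UnitAddCircle) : Type :=
  ConnectedComponents ↥(⋃ i, toricHyperplane (v i) (c i))ᶜ

/-- The line arrangement on `𝕋²` with normal vectors `a` and intercepts `b` has no triple
intersection: no three of its lines have a common point. -/
def NoTriple {m : ℕ} (a : Fin m → Fin 2 → ℤ) (b : Fin m → UnitAddCircle) : Prop :=
  ∀ i j k : Fin m, i ≠ j → i ≠ k → j ≠ k →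
    toricHyperplane (a i) (b i) ∩ toricHyperplane (a j) (b j) ∩ toricHyperplane (a k) (b k) = ∅

/-- The arrangements without triple intersection whose lines have normal vectors `a`; such an
arrangement is given by its vector of intercepts. -/
abbrev LineArrangement {m : ℕ} (a : Fin m → Fin 2 → ℤ) : Type :=
  {b : Fin m → UnitAddCircle // NoTriple a b}

/-- Two arrangements with the same normal vectors are equivalent if the lines of the first can be
translated continuously (the intercepts moved along a path) to the lines of the second without
creating a triple intersection at any time. -/
def translationSetoid {m : ℕ} (a : Fin m → Fin 2 → ℤ) : Setoid (LineArrangement a) where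
  r b c := ∃ γ : Path b.1 c.1, ∀ t, NoTriple a (γ t)
  iseqv :=
    { refl := fun b => JoinedIn.refl (F := {b | NoTriple a b}) b.2
      symm := fun h => JoinedIn.symm (F := {b | NoTriple a b}) h
      trans := fun h h' => JoinedIn.trans (F := {b | NoTriple a b}) h h' }

/-- The inequivalent arrangements of lines with normal vectors `a`. -/
abbrev ArrangementClass {m : ℕ} (a : Fin m → Fin 2 → ℤ) : Type :=
  Quotient (translationSetoid a)

/-- The determinant of two vectors in the plane. -/
def det₂ (u v : Fin 2 → ℤ) : ℤ :=
  (Matrix.of ![u, v]).det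

/-- The unordered triples of indices, listed increasingly, whose three normal vectors span the
plane. -/
abbrev SpanningTriple {m : ℕ} (a : Fin m → Fin 2 → ℤ) : Type :=
  {t : Fin 3 ↪o Fin m // ∃ r s : Fin 3, det₂ (a (t r)) (a (t s)) ≠ 0}

/-- The primitive vector obtained from a nonzero integer vector by dividing by the greatest common
divisor of its entries. -/
def primitivePart (v : Fin 3 → ℤ) : Fin 3 → ℤ :=
  fun s => v s / Finset.univ.gcd v

/-- The primitive cross product of the two columns of the `3 × 2` matrix whose rows are the normal
vectors of the triple. -/
def tripleNormal {m : ℕ} (a : Fin m → Fin 2 → ℤ) (t : SpanningTriple a) : Fin 3 → ℤ :=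
  primitivePart ((fun s => a (t.1 s) 0) ⨯₃ (fun s => a (t.1 s) 1))

/-- The extended vector: the entries of the primitive cross product at the three indices of the
triple, and zero elsewhere. -/
def extendedNormal {m : ℕ} (a : Fin m → Fin 2 → ℤ) (t : SpanningTriple a) : Fin m → ℤ :=
  Function.extend t.1 (tripleNormal a t) 0

/-- The indices that remain when `g` and `h` are omitted. -/
abbrev OtherIndex {m : ℕ} (g h : Fin m) : Type :=
  {l : Fin m // l ≠ g ∧ l ≠ h}

/-- The reduced extended vector: the entries at `g` and `h` are omitted. -/
def reducedNormal {m : ℕ} (a : Fin m → Fin 2 → ℤ) (g h : Fin m) (t : SpanningTriple a) :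
    OtherIndex g h → ℤ :=
  fun l => extendedNormal a t l.1

/-- The `(m - 2)`-flats of the parameter arrangement on `𝕋^(m-2)`: all its hyperplanes, one for
each spanning triple, have intercept zero. -/
abbrev ParameterFlats {m : ℕ} (a : Fin m → Fin 2 → ℤ) (g h : Fin m) : Type :=
  TopFlats (reducedNormal a g h) 0

/-- The absolute value of the determinant of an integer matrix whose rows and columns are indexed
by two finite types of the same cardinality (and zero if the cardinalities differ). -/
def absDet {ι κ : Type} [Fintype ι] (M : Matrix ι κ ℤ) : ℤ :=
  if e : Nonempty (ι ≃ κ) then |(M.submatrix id e.some).det| else 0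

/-- The value does not depend on how rows and columns are matched. -/
theorem absDet_eq {ι κ : Type} [Fintype ι] (M : Matrix ι κ ℤ) (e : ι ≃ κ) :
    absDet M = |(M.submatrix id e).det| := by
  have hne : Nonempty (ι ≃ κ) := ⟨e⟩
  have h := Matrix.abs_det_submatrix_equiv_equiv (Equiv.refl ι) (hne.some.trans e.symm)
    (M.submatrix id e)
  rw [absDet, dif_pos hne, ← h]
  congr 2
  ext i j
  simp

/-- The sum, over all sets of `m - 2` spanning triples, of the absolute value of the determinant of
the square matrix formed by the reduced extended vectors of these triples. -/
def determinantSum {m : ℕ} (a : Fin m → Fin 2 → ℤ) (g h : Fin m) : ℤ :=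
  ∑ J ∈ Finset.powersetCard (m - 2) (Finset.univ : Finset (SpanningTriple a)),
    absDet (Matrix.of fun (t : {t // t ∈ J}) (l : OtherIndex g h) => reducedNormal a g h t.1 l)

end

/-! Write `D` for `|det₂ (a g) (a h)|`. Three lines with spanning normals meet exactly when the
primitive cross product annihilates their intercepts (`exists_common_point_iff`). A triple point
involving parallel lines produces a spanning one, so triple intersections are governed by the
hyperplanes of the spanning triples alone (`noTriple_iff`). Moving the origin of the 2-torus
preserves all these conditions, so every class has a representative with zero intercepts at `g` and
`h`. Flats of the parameter arrangement therefore map onto classes (`classOfFlat_surjective`),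
whence N ≤ f.

The factor e/D comes from an ambiguity: the origin may be placed at any of the D common points of
the two fixed lines. Translating by these points permutes the flats belonging to one class, and two
translations send a flat to the same flat only if they differ by a point annihilated by all normals
(`eq_of_mk_add_eq`). There are e such points (`card_torusAnnihilator`), so N·D ≤ e·f
(`card_classes_mul_card_le`).

For f ≤ S, lift to the periodic arrangement in Euclidean space and shift its hyperplanes by tiny,
rationally independent amounts. Every original cell survives, and a generic linear functional
attains its minimum over the closed cell at a vertex on exactly m - 2 hyperplanes (`exists_vertex`).
Vertex and hyperplanes together determine the cell. Modulo the lattice, m - 2 given independent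
hyperplanes have at most as many common points as the absolute value of their determinant
(`card_solutions_le_absDet`); summing gives `card_le_sum_absDet`. -/

noncomputable section

/-! ### Duality between subgroups of the character lattice and subgroups of the torus -/

/-- The pairing of a point of the torus with the characters of the torus. -/
def torusPairing {κ : Type} [Fintype κ] (x : κ → UnitAddCircle) : (κ → ℤ) →+ UnitAddCircle where
  toFun u := ∑ l, u l • x l
  map_zero' := by simp
  map_add' u v := by simp [add_smul, Finset.sum_add_distrib]

/-- The points of the torus that are annihilated by all characters in `L`. -/
def torusAnnihilator {κ : Type} [Fintype κ] (L : AddSubgroup (κ → ℤ)) :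
    AddSubgroup (κ → UnitAddCircle) where
  carrier := {x | ∀ u ∈ L, ∑ l, u l • x l = 0}
  zero_mem' := by simp
  add_mem' {x y} hx hy u hu := by
    simp only [Pi.add_apply, smul_add, Finset.sum_add_distrib, hx u hu, hy u hu, add_zero]
  neg_mem' {x} hx u hu := by
    simp only [Pi.neg_apply, smul_neg, Finset.sum_neg_distrib, hx u hu, neg_zero]

theorem mem_torusAnnihilator_closure {κ : Type} [Fintype κ] {s : Set (κ → ℤ)}
    {x : κ → UnitAddCircle} :
    x ∈ torusAnnihilator (AddSubgroup.closure s) ↔ ∀ u ∈ s, ∑ l, u l • x l = 0 := by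
  refine ⟨fun hx u hu => hx u (AddSubgroup.subset_closure hu), fun hx => ?_⟩
  have : AddSubgroup.closure s ≤ (torusPairing x).ker :=
    (AddSubgroup.closure_le _).2 fun u hu => hx u hu
  exact fun u hu => this hu

theorem AddChar.map_finset_sum {A M ι : Type*} [AddCommMonoid A] [CommMonoid M] (ψ : AddChar A M)
    (s : Finset ι) (f : ι → A) : ψ (∑ i ∈ s, f i) = ∏ i ∈ s, ψ (f i) := by
  induction s using Finset.induction_on with
  | empty => simp
  | insert i s hi ih => rw [Finset.sum_insert hi, Finset.prod_insert hi, map_add_eq_mul, ih]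

/-- The character of `ℤ^κ / L` given by a point annihilated by `L`. -/
def annihilatorChar {κ : Type} [Fintype κ] (L : AddSubgroup (κ → ℤ)) (x : torusAnnihilator L) :
    AddChar ((κ → ℤ) ⧸ L) Circle :=
  AddCircle.toCircle_addChar.compAddMonoidHom
    (QuotientAddGroup.lift L (torusPairing x.1) fun u hu => x.2 u hu)

theorem annihilatorChar_mk {κ : Type} [Fintype κ] (L : AddSubgroup (κ → ℤ))
    (x : torusAnnihilator L) (u : κ → ℤ) :
    annihilatorChar L x (QuotientAddGroup.mk u) = AddCircle.toCircle (∑ l, u l • x.1 l) := rfl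

/-- A character of the quotient is determined by its values on the coordinate vectors, and these
values, read in ℝ/ℤ, are the coordinates of the corresponding point. -/
theorem annihilatorChar_bijective {κ : Type} [Fintype κ] (L : AddSubgroup (κ → ℤ)) :
    Function.Bijective (annihilatorChar L) := by
  constructor
  · intro x y hxy
    ext l
    have h := DFunLike.congr_fun hxy (QuotientAddGroup.mk (Pi.single l 1))
    simp only [annihilatorChar_mk] at h
    have h := AddCircle.injective_toCircle one_ne_zero h
    simpa [Pi.single_apply] using h
  · intro ψ
    set x : κ → UnitAddCircle := fun l =>
      (AddCircle.homeomorphCircle one_ne_zero).symm (ψ (QuotientAddGroup.mk (Pi.single l 1)))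
      with hx
    have hxl (l : κ) : AddCircle.toCircle (x l) = ψ (QuotientAddGroup.mk (Pi.single l 1)) := by
      rw [← AddCircle.homeomorphCircle_apply one_ne_zero, hx, Homeomorph.apply_symm_apply]
    have key (u : κ → ℤ) : AddCircle.toCircle (∑ l, u l • x l) = ψ (QuotientAddGroup.mk u) := by
      have h1 : (u : κ → ℤ) = ∑ l, u l • Pi.single l 1 := by
        ext k
        simp [Finset.sum_apply, Pi.single_apply]
      have h2 : (QuotientAddGroup.mk u : (κ → ℤ) ⧸ L) =
          ∑ l, u l • QuotientAddGroup.mk (Pi.single l 1) := by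
        conv_lhs => rw [h1]
        exact map_sum (QuotientAddGroup.mk' L) _ _
      rw [h2, AddChar.map_finset_sum]
      change AddCircle.toCircle_addChar _ = _
      rw [AddChar.map_finset_sum]
      refine Finset.prod_congr rfl fun l _ => ?_
      rw [AddChar.map_zsmul_eq_zpow, AddChar.map_zsmul_eq_zpow, ← hxl]
      rfl
    refine ⟨⟨x, fun u hu => ?_⟩, ?_⟩
    · apply AddCircle.injective_toCircle one_ne_zero
      rw [key, AddCircle.toCircle_zero, (QuotientAddGroup.eq_zero_iff u).2 hu,
        AddChar.map_zero_eq_one]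
    · ext q
      obtain ⟨u, rfl⟩ := QuotientAddGroup.mk_surjective q
      rw [annihilatorChar_mk, key]

theorem finite_torusAnnihilator {κ : Type} [Fintype κ] (L : AddSubgroup (κ → ℤ))
    [L.FiniteIndex] : Finite (torusAnnihilator L) := by
  have := Fintype.ofFinite ((κ → ℤ) ⧸ L)
  have : Finite (AddChar ((κ → ℤ) ⧸ L) Circle) :=
    Finite.of_equiv _ AddChar.circleEquivComplex.symm.toEquiv
  exact Finite.of_injective _ (annihilatorChar_bijective L).1

/-- The annihilator is the dual of the finite quotient group, and a finite abelian group has as many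
characters as elements. -/
theorem card_torusAnnihilator {κ : Type} [Fintype κ] (L : AddSubgroup (κ → ℤ))
    [L.FiniteIndex] : Nat.card (torusAnnihilator L) = L.index := by
  have := Fintype.ofFinite ((κ → ℤ) ⧸ L)
  rw [Nat.card_eq_of_bijective _ (annihilatorChar_bijective L),
    Nat.card_congr AddChar.circleEquivComplex.toEquiv, Nat.card_eq_fintype_card, AddChar.card_eq,
    AddSubgroup.index_eq_card, Nat.card_eq_fintype_card]

/-! ### Determinants and linear systems on the torus -/

theorem index_closure_range_eq_natAbs_det {κ : Type} [Fintype κ] [DecidableEq κ]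
    (N : Matrix κ κ ℤ) (hN : N.det ≠ 0) :
    (AddSubgroup.closure (Set.range N)).index = N.det.natAbs := by
  have hli : LinearIndependent ℤ N := Matrix.linearIndependent_rows_of_det_ne_zero hN
  have h := Submodule.natAbs_det_basis_change (Pi.basisFun ℤ κ) _ (Module.Basis.span hli)
  rw [← Submodule.span_int_eq_addSubgroupClosure]
  rw [Pi.basisFun_det_apply] at h
  refine h.symm.trans ?_
  congr 2
  ext i j
  exact congrFun (congrArg Subtype.val (Module.Basis.span_apply hli i)) j

/-- Subtracting one solution embeds the solution set into the annihilator of the row lattice, whose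
order is the index of that lattice. -/
theorem card_solutions_le_absDet {ι κ : Type} [Fintype ι] [Fintype κ] (N : Matrix ι κ ℤ)
    (hN : absDet N ≠ 0) (c : ι → UnitAddCircle) :
    Finite {x : κ → UnitAddCircle // ∀ i, ∑ l, N i l • x l = c i} ∧
    (Nat.card {x : κ → UnitAddCircle // ∀ i, ∑ l, N i l • x l = c i} : ℤ) ≤ absDet N := by
  have he : Nonempty (ι ≃ κ) := by
    by_contra h
    exact hN (dif_neg h)
  obtain ⟨e⟩ := he
  rw [absDet_eq N e] at hN ⊢
  set L := AddSubgroup.closure (Set.range N) with hL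
  have hidx : L.index = (N.submatrix id e).det.natAbs := by
    have h1 : (N.submatrix e.symm id).det = (N.submatrix id e).det :=
      (Matrix.det_submatrix_equiv_self e.symm (N.submatrix id e)) ▸ by
        congr 1
        ext i j
        simp
    have h2 : Set.range (N.submatrix e.symm id) = Set.range N :=
      e.symm.surjective.range_comp N
    rw [hL, ← h2, index_closure_range_eq_natAbs_det _ (by rw [h1]; simpa using hN), h1]
  have hne : L.index ≠ 0 := by
    rw [hidx]
    simpa using hN
  have : L.FiniteIndex := ⟨hne⟩
  have := finite_torusAnnihilator L
  rcases isEmpty_or_nonempty {x : κ → UnitAddCircle // ∀ i, ∑ l, N i l • x l = c i} with h | ⟨⟨x₀⟩⟩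
  · exact ⟨inferInstance, by simp⟩
  · let F : {x : κ → UnitAddCircle // ∀ i, ∑ l, N i l • x l = c i} → torusAnnihilator L :=
      fun x => ⟨x.1 - x₀.1, mem_torusAnnihilator_closure.2 (by
        rintro _ ⟨i, rfl⟩
        simp only [Pi.sub_apply, smul_sub, Finset.sum_sub_distrib, x.2 i, x₀.2 i, sub_self])⟩
    have hF : Function.Injective F := fun x y hxy => by
      have := congrArg Subtype.val hxy
      exact Subtype.ext (sub_left_injective this)
    refine ⟨Finite.of_injective F hF, ?_⟩
    have h := Nat.card_le_card_of_injective F hF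
    rw [card_torusAnnihilator, hidx] at h
    rw [Int.abs_eq_natAbs]
    exact_mod_cast h

/-! ### Universal cover and cells of a central toric arrangement -/

/-- The value at `x` of the linear form with integer coefficients `u`. -/
def realPairing {κ : Type} [Fintype κ] (u : κ → ℤ) : (κ → ℝ) →ₗ[ℝ] ℝ where
  toFun x := ∑ l, (u l : ℝ) * x l
  map_add' x y := by simp [mul_add, Finset.sum_add_distrib]
  map_smul' c x := by
    simp only [Pi.smul_apply, smul_eq_mul, RingHom.id_apply, Finset.mul_sum]
    exact Finset.sum_congr rfl fun l _ => by ring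

theorem realPairing_apply {κ : Type} [Fintype κ] (u : κ → ℤ) (x : κ → ℝ) :
    realPairing u x = ∑ l, (u l : ℝ) * x l := rfl

theorem continuous_realPairing {κ : Type} [Fintype κ] (u : κ → ℤ) :
    Continuous (realPairing u) := LinearMap.continuous_of_finiteDimensional _

theorem realPairing_intCast {κ : Type} [Fintype κ] (u z : κ → ℤ) :
    realPairing u (fun l => (z l : ℝ)) = ((∑ l, u l * z l : ℤ) : ℝ) := by
  simp [realPairing_apply]

/-- The universal covering map of the torus. -/
def torusProj {κ : Type} (x : κ → ℝ) : κ → UnitAddCircle := fun l => (x l : UnitAddCircle)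

theorem isOpenQuotientMap_torusProj {κ : Type} :
    IsOpenQuotientMap (torusProj : (κ → ℝ) → κ → UnitAddCircle) :=
  IsOpenQuotientMap.piMap fun _ => QuotientAddGroup.isOpenQuotientMap_mk

theorem torusProj_add {κ : Type} (x y : κ → ℝ) :
    torusProj (x + y) = torusProj x + torusProj y := rfl

theorem torusProj_eq_iff {κ : Type} {x y : κ → ℝ} :
    torusProj x = torusProj y ↔ ∃ z : κ → ℤ, x = y + fun l => (z l : ℝ) := by
  constructor
  · intro hxy
    have h (l : κ) : ∃ n : ℤ, (n : ℝ) = x l - y l := by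
      have : ((x l - y l : ℝ) : UnitAddCircle) = 0 := by
        rw [AddCircle.coe_sub, sub_eq_zero]
        exact congrFun hxy l
      simpa using (AddCircle.coe_eq_zero_iff _).1 this
    choose z hz using h
    exact ⟨z, funext fun l => by simp [hz]⟩
  · rintro ⟨z, rfl⟩
    funext l
    simp [torusProj]

theorem coe_realPairing {κ : Type} [Fintype κ] (u : κ → ℤ) (x : κ → ℝ) :
    ((realPairing u x : ℝ) : UnitAddCircle) = ∑ l, u l • torusProj x l := by
  rw [realPairing_apply]
  refine (map_sum (QuotientAddGroup.mk' (AddSubgroup.zmultiples (1 : ℝ))) _ _).trans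
    (Finset.sum_congr rfl fun l _ => ?_)
  rw [← zsmul_eq_mul]
  exact map_zsmul (QuotientAddGroup.mk' (AddSubgroup.zmultiples (1 : ℝ))) _ _

/-- The complement of the union of the toric hyperplanes through the origin with normals `v`. -/
abbrev toricComplement {ι κ : Type} [Fintype κ] (v : ι → κ → ℤ) : Set (κ → UnitAddCircle) :=
  (⋃ i, toricHyperplane (v i) ((0 : ι → UnitAddCircle) i))ᶜ

theorem mem_toricComplement {ι κ : Type} [Fintype κ] {v : ι → κ → ℤ} {p : κ → UnitAddCircle} :
    p ∈ toricComplement v ↔ ∀ i, ∑ l, v i l • p l ≠ 0 := by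
  simp [toricHyperplane]

theorem torusProj_mem_toricComplement {ι κ : Type} [Fintype κ] {v : ι → κ → ℤ} {x : κ → ℝ} :
    torusProj x ∈ toricComplement v ↔ ∀ i, (⌊realPairing (v i) x⌋ : ℝ) < realPairing (v i) x := by
  rw [mem_toricComplement]
  refine forall_congr' fun i => ?_
  rw [← coe_realPairing, Ne, AddCircle.coe_eq_zero_iff]
  constructor
  · exact fun h => lt_of_le_of_ne (Int.floor_le _) fun h' => h ⟨_, by simpa using h'⟩
  · rintro h ⟨n, hn⟩
    rw [← hn] at h
    simp at h

/-- Two points of the universal cover lie, up to a lattice translation, in the same cell of the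
periodic hyperplane arrangement with normals `v`. -/
def SameCell {ι κ : Type} [Fintype κ] (v : ι → κ → ℤ) (x y : κ → ℝ) : Prop :=
  ∃ z : κ → ℤ, ∀ i, ⌊realPairing (v i) x⌋ = ⌊realPairing (v i) y⌋ + ∑ l, v i l * z l

/-- After a lattice translation both lifts lie in one intersection of open slabs. It is convex and
projects into the complement. -/
theorem SameCell.joinedIn {ι κ : Type} [Fintype κ] {v : ι → κ → ℤ} {x y : κ → ℝ}
    (hx : torusProj x ∈ toricComplement v) (hy : torusProj y ∈ toricComplement v)
    (h : SameCell v x y) : JoinedIn (toricComplement v) (torusProj x) (torusProj y) := by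
  obtain ⟨z, hz⟩ := h
  set y' : κ → ℝ := y + fun l => (z l : ℝ) with hy'
  have hyy : torusProj y' = torusProj y := torusProj_eq_iff.2 ⟨z, rfl⟩
  rw [← hyy] at hy ⊢
  have hfl (i) : ⌊realPairing (v i) y'⌋ = ⌊realPairing (v i) x⌋ := by
    rw [hy', map_add, realPairing_intCast, Int.floor_add_intCast, hz]
  set Y : Set (κ → ℝ) := {w | ∀ i, realPairing (v i) w ∈
    Set.Ioo (⌊realPairing (v i) x⌋ : ℝ) (⌊realPairing (v i) x⌋ + 1)} with hY
  have hYc : Convex ℝ Y := by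
    rw [hY, Set.ofPred_forall]
    exact convex_iInter fun i => (convex_Ioo _ _).linear_preimage (realPairing (v i))
  have hxY : x ∈ Y := fun i => ⟨torusProj_mem_toricComplement.1 hx i, Int.lt_floor_add_one _⟩
  have hyY : y' ∈ Y := fun i => by
    rw [← hfl i]
    exact ⟨torusProj_mem_toricComplement.1 hy i, Int.lt_floor_add_one _⟩
  have hj : JoinedIn Y x y' := (hYc.isPathConnected ⟨x, hxY⟩).joinedIn x hxY y' hyY
  refine (hj.map isOpenQuotientMap_torusProj.continuous).mono ?_
  rintro _ ⟨w, hw, rfl⟩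
  refine torusProj_mem_toricComplement.2 fun i => ?_
  have : ⌊realPairing (v i) w⌋ = ⌊realPairing (v i) x⌋ :=
    Int.floor_eq_iff.2 ⟨(hw i).1.le, (hw i).2⟩
  rw [this]
  exact (hw i).1

theorem eventually_floor_realPairing_eq {ι κ : Type} [Finite ι] [Fintype κ] {v : ι → κ → ℤ}
    {x : κ → ℝ} (hx : torusProj x ∈ toricComplement v) :
    ∀ᶠ y in nhds x, ∀ i, ⌊realPairing (v i) y⌋ = ⌊realPairing (v i) x⌋ := by
  rw [Filter.eventually_all]
  intro i
  have h := (continuous_realPairing (v i)).continuousAt.eventually_mem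
    (Ioo_mem_nhds (torusProj_mem_toricComplement.1 hx i) (Int.lt_floor_add_one _))
  filter_upwards [h] with y hy
  exact Int.floor_eq_iff.2 ⟨hy.1.le, hy.2⟩

/-- The floor vector of a lift depends on the lift, but the set of floor vectors of all lifts
depends only on the point. It is locally constant, hence constant on connected components. -/
theorem sameCell_of_mk_eq {ι κ : Type} [Finite ι] [Fintype κ] {v : ι → κ → ℤ}
    {p q : toricComplement v} (h : (p : ConnectedComponents (toricComplement v)) = q)
    {x y : κ → ℝ} (hx : torusProj x = p) (hy : torusProj y = q) : SameCell v x y := by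
  set Φ : toricComplement v → Set (ι → ℤ) := fun r =>
    {k | ∃ w, torusProj w = r.1 ∧ k = fun i => ⌊realPairing (v i) w⌋} with hΦ
  have hlc : IsLocallyConstant Φ := by
    refine (IsLocallyConstant.iff_eventually_eq Φ).2 fun r => ?_
    obtain ⟨w, hw⟩ := isOpenQuotientMap_torusProj.surjective r.1
    have hev := eventually_floor_realPairing_eq (hw ▸ r.2 : torusProj w ∈ toricComplement v)
    have := isOpenQuotientMap_torusProj.isOpenMap.image_mem_nhds hev
    rw [hw] at this
    filter_upwards [continuous_subtype_val.continuousAt.preimage_mem_nhds this] with s hs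
    obtain ⟨w', hw', hs⟩ := hs
    have key : ∀ {r₁ r₂ : toricComplement v} {w₁ w₂ : κ → ℝ}, torusProj w₁ = r₁.1 →
        torusProj w₂ = r₂.1 →
        (∀ i, ⌊realPairing (v i) w₁⌋ = ⌊realPairing (v i) w₂⌋) → Φ r₁ ⊆ Φ r₂ := by
      rintro r₁ r₂ w₁ w₂ h₁ h₂ h₁₂ _ ⟨u, hu, rfl⟩
      obtain ⟨z, rfl⟩ := torusProj_eq_iff.1 (hu.trans h₁.symm)
      refine ⟨w₂ + fun l => (z l : ℝ), (torusProj_eq_iff.2 ⟨z, rfl⟩).trans h₂, ?_⟩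
      funext i
      simp only [map_add, realPairing_intCast, Int.floor_add_intCast, h₁₂]
    exact (key hs hw hw').antisymm (key hw hs fun i => (hw' i).symm)
  have hpq : Φ p = Φ q := hlc.apply_eq_of_isPreconnected isPreconnected_connectedComponent
    mem_connectedComponent (ConnectedComponents.coe_eq_coe'.1 h.symm)
  have hmem : (fun i => ⌊realPairing (v i) x⌋) ∈ Φ q := hpq ▸ ⟨x, hx, rfl⟩
  obtain ⟨w, hw, hk⟩ := hmem
  obtain ⟨z, rfl⟩ := torusProj_eq_iff.1 (hw.trans hy.symm)
  refine ⟨z, fun i => ?_⟩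
  rw [congrFun hk i, map_add, realPairing_intCast, Int.floor_add_intCast]

theorem mk_eq_of_sameCell {ι κ : Type} [Fintype κ] {v : ι → κ → ℤ}
    {p q : toricComplement v} {x y : κ → ℝ} (hx : torusProj x = p) (hy : torusProj y = q)
    (h : SameCell v x y) : (p : ConnectedComponents (toricComplement v)) = q := by
  have hj := h.joinedIn (hx ▸ p.2) (hy ▸ q.2)
  simp only [hx, hy] at hj
  exact (ConnectedComponents.coe_eq_coe'.2
    (pathComponent_subset_component q hj.symm.joined_subtype))

/-! ### Generic perturbation and vertices of cells -/

/-- There are arbitrarily small real numbers that satisfy no nontrivial affine relation with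
rational coefficients. -/
theorem exists_small_rationally_independent (ι : Type) [Fintype ι] {ε : ℝ} (hε : 0 < ε) :
    ∃ c : ι → ℝ, (∀ i, |c i| < ε) ∧
      ∀ (q : ι → ℚ) (r : ℚ), ∑ i, (q i : ℝ) * c i = r → q = 0 := by
  obtain ⟨α, hα⟩ : ∃ α : ℝ, Transcendental ℚ α :=
    ⟨_, fun h => transcendental_liouvilleNumber (m := 2) le_rfl
      ((IsFractionRing.isAlgebraic_iff ℤ ℚ ℝ).2 h)⟩
  set e := Fintype.equivFin ι
  obtain ⟨M, hM⟩ : ∃ M : ℕ, ∀ i : ι, |α ^ ((e i : ℕ) + 1)| / ε < M := by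
    obtain ⟨M, hM⟩ := exists_nat_gt (∑ i : ι, |α ^ ((e i : ℕ) + 1)| / ε)
    refine ⟨M, fun i => lt_of_le_of_lt ?_ hM⟩
    exact Finset.single_le_sum (f := fun i : ι => |α ^ ((e i : ℕ) + 1)| / ε)
      (fun i _ => by positivity) (Finset.mem_univ i)
  -- Distinct positive powers of a transcendental number, scaled down by `M`. The exponents start at
  -- 1, so the constant term is free to absorb `r`.
  refine ⟨fun i => α ^ ((e i : ℕ) + 1) / M, fun i => ?_, fun q r hqr => ?_⟩
  · have hM0 : (0 : ℝ) < M := lt_of_le_of_lt (by positivity) (hM i)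
    rw [abs_div, abs_of_pos hM0, div_lt_iff₀ hM0]
    have := (div_lt_iff₀ hε).1 (hM i)
    linarith
  · funext i
    have hM0 : (M : ℝ) ≠ 0 := (lt_of_le_of_lt (by positivity) (hM i)).ne'
    set p : Polynomial ℚ := ∑ i, Polynomial.C (q i) * Polynomial.X ^ ((e i : ℕ) + 1) -
      Polynomial.C (r * M) with hp
    have hroot : Polynomial.aeval α p = 0 := by
      simp only [hp, map_sub, map_sum, map_mul, Polynomial.aeval_C, map_pow, Polynomial.aeval_X,
        eq_ratCast, map_natCast]
      rw [← hqr, Finset.sum_mul, sub_eq_zero]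
      refine Finset.sum_congr rfl fun i _ => ?_
      field_simp
    have hp0 : p = 0 := by
      by_contra h
      exact hα ⟨p, h, hroot⟩
    have := congrArg (Polynomial.coeff · ((e i : ℕ) + 1)) hp0
    simpa [hp, Polynomial.coeff_C, Polynomial.coeff_X_pow, Fin.val_inj] using this

/-- The real vector that represents a rational linear form. -/
def dualVector {κ : Type} (f : (κ → ℚ) →ₗ[ℚ] ℚ) : κ → ℝ :=
  fun l => (f (Pi.single l 1) : ℝ)

theorem realPairing_dualVector {κ : Type} [Fintype κ] (f : (κ → ℚ) →ₗ[ℚ] ℚ) (u : κ → ℤ) :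
    realPairing u (dualVector f) = (f (fun l => (u l : ℚ)) : ℝ) := by
  rw [realPairing_apply, LinearMap.pi_apply_eq_sum_univ f]
  push_cast
  refine Finset.sum_congr rfl fun l _ => ?_
  simp only [dualVector, smul_eq_mul]
  push_cast
  congr 4
  ext k
  simp [Pi.single_apply, eq_comm]

/-- Genericity of the objective: it is constant along no rational direction. -/
theorem sum_mul_dualVector_ne_zero {κ : Type} [Fintype κ] {c : κ → ℝ}
    (hc : ∀ (q : κ → ℚ) (r : ℚ), ∑ l, (q l : ℝ) * c l = r → q = 0)
    {f : (κ → ℚ) →ₗ[ℚ] ℚ} (hf : f ≠ 0) : ∑ l, dualVector f l * c l ≠ 0 := by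
  intro h
  refine hf ?_
  have := hc (fun l => f (Pi.single l 1)) 0 (by simpa [dualVector] using h)
  ext l
  simpa using congrFun this l

/-- The closed polyhedron between consecutive hyperplanes with normals `v` and intercepts
`c + k` and `c + k + 1`. -/
def cellClosure {ι κ : Type} [Fintype κ] (v : ι → κ → ℤ) (c : ι → ℝ) (k : ι → ℤ) : Set (κ → ℝ) :=
  {x | ∀ i, (k i : ℝ) ≤ realPairing (v i) x - c i ∧ realPairing (v i) x - c i ≤ k i + 1}

/-- Since the normals have no common kernel, evaluating them is a closed embedding, and the cell is
the preimage of a box. -/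
theorem isCompact_cellClosure {ι κ : Type} [Fintype ι] [Fintype κ] {v : ι → κ → ℤ}
    (hv : ∀ d : κ → ℝ, (∀ i, realPairing (v i) d = 0) → d = 0) (c : ι → ℝ) (k : ι → ℤ) :
    IsCompact (cellClosure v c k) := by
  have hker : LinearMap.ker (LinearMap.pi fun i => realPairing (v i)) = ⊥ :=
    LinearMap.ker_eq_bot'.2 fun d hd => hv d fun i => congrFun hd i
  have hcl := LinearMap.isClosedEmbedding_of_injective hker
  convert! hcl.isCompact_preimage (isCompact_univ_pi fun i =>
    isCompact_Icc (a := (k i + c i : ℝ)) (b := k i + 1 + c i)) using 1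
  ext x
  simp only [cellClosure, Set.mem_ofPred_eq, Set.mem_preimage, Set.mem_pi, Set.mem_univ,
    forall_true_left, Set.mem_Icc, LinearMap.pi_apply]
  exact forall_congr' fun i =>
    and_congr ⟨fun h => by linarith, fun h => by linarith⟩
      ⟨fun h => by linarith, fun h => by linarith⟩

/-- First-order optimality: a direction that violates no active constraint stays in the cell for
small positive times, so it cannot decrease the objective. -/
theorem nonneg_of_isMinOn_cellClosure {ι κ : Type} [Finite ι] [Fintype κ] {v : ι → κ → ℤ}
    {c : ι → ℝ} {k : ι → ℤ} {ξ : κ → ℝ} {w : κ → ℝ} (hw : w ∈ cellClosure v c k)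
    (hmin : IsMinOn (fun x => ∑ l, x l * ξ l) (cellClosure v c k) w) {d : κ → ℝ}
    (hlow : ∀ i, realPairing (v i) w - c i = k i → 0 ≤ realPairing (v i) d)
    (hup : ∀ i, realPairing (v i) w - c i = k i + 1 → realPairing (v i) d ≤ 0) :
    0 ≤ ∑ l, d l * ξ l := by
  by_contra! hneg
  have hev : ∀ᶠ t : ℝ in nhdsWithin 0 (Set.Ioi 0), ∀ i,
      (k i : ℝ) ≤ realPairing (v i) w - c i + t * realPairing (v i) d ∧
        realPairing (v i) w - c i + t * realPairing (v i) d ≤ k i + 1 := by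
    rw [Filter.eventually_all]
    intro i
    have hcont : Filter.Tendsto (fun t : ℝ => realPairing (v i) w - c i + t * realPairing (v i) d)
        (nhdsWithin 0 (Set.Ioi 0)) (nhds (realPairing (v i) w - c i)) := by
      have : Continuous fun t : ℝ => realPairing (v i) w - c i + t * realPairing (v i) d := by
        fun_prop
      simpa using (this.tendsto 0).mono_left nhdsWithin_le_nhds
    have h0 : ∀ᶠ t : ℝ in nhdsWithin 0 (Set.Ioi 0), 0 < t := self_mem_nhdsWithin
    refine Filter.Eventually.and ?_ ?_
    · rcases (hw i).1.eq_or_lt with h | h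
      · filter_upwards [h0] with t ht
        have := mul_nonneg ht.le (hlow i h.symm)
        linarith
      · filter_upwards [hcont.eventually_mem (Ioi_mem_nhds h)] with t ht using ht.le
    · rcases (hw i).2.eq_or_lt with h | h
      · filter_upwards [h0] with t ht
        have := mul_nonpos_of_nonneg_of_nonpos ht.le (hup i h)
        linarith
      · filter_upwards [hcont.eventually_mem (Iio_mem_nhds h)] with t ht using ht.le
  obtain ⟨t, ht, ht0⟩ := (hev.and self_mem_nhdsWithin).exists
  have hmem : w + t • d ∈ cellClosure v c k := fun i => by
    rw [map_add, map_smul, smul_eq_mul, add_sub_right_comm]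
    exact ht i
  have h : ∑ l, w l * ξ l ≤ ∑ l, (w + t • d) l * ξ l := hmin hmem
  simp only [Pi.add_apply, Pi.smul_apply, smul_eq_mul, add_mul, Finset.sum_add_distrib, mul_assoc,
    ← Finset.mul_sum] at h
  have := mul_neg_of_pos_of_neg (Set.mem_Ioi.1 ht0) hneg
  linarith

/-- The rational row of an integer matrix. -/
def ratRow {ι κ : Type} (v : ι → κ → ℤ) (i : ι) : κ → ℚ := fun l => (v i l : ℚ)

theorem exists_linearIndependent_rows {ι κ : Type} [Finite ι] [Fintype κ] {v : ι → κ → ℤ} {A : Set ι}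
    (hA : Submodule.span ℚ (ratRow v '' A) = ⊤) :
    ∃ J : Finset ι, ↑J ⊆ A ∧ J.card = Fintype.card κ ∧
      LinearIndependent ℚ (fun j : J => ratRow v j) := by
  obtain ⟨B, hBA, -, hspan, hli⟩ := exists_linearIndepOn_extension
    (linearIndepOn_empty ℚ (ratRow v)) (Set.empty_subset A)
  have htop : Submodule.span ℚ (ratRow v '' B) = ⊤ :=
    top_le_iff.1 (hA ▸ Submodule.span_le.2 hspan)
  have hli' : LinearIndependent ℚ (fun j : B.toFinite.toFinset => ratRow v j) :=
    hli.comp (fun j : B.toFinite.toFinset => (⟨j, (Set.Finite.mem_toFinset _).1 j.2⟩ : B))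
      fun i j h => Subtype.ext (Subtype.mk.inj h)
  have hrange : Set.range (fun j : B.toFinite.toFinset => ratRow v j) = ratRow v '' B := by
    ext u
    simp
  refine ⟨B.toFinite.toFinset, by simpa using hBA, ?_, hli'⟩
  have := finrank_span_eq_card hli'
  rw [hrange, htop, finrank_top, Module.finrank_fintype_fun_eq_card, Fintype.card_coe] at this
  exact this.symm

/-- A further hyperplane through `w` would have its normal in the rational span of those in `J`,
which yields a nontrivial rational affine relation among the shifts `c`. -/
theorem eq_of_active {ι κ : Type} [Fintype ι] [Fintype κ] {v : ι → κ → ℤ} {c : ι → ℝ}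
    (hc : ∀ (q : ι → ℚ) (r : ℚ), ∑ i, (q i : ℝ) * c i = r → q = 0) {J : Finset ι}
    (hspan : Submodule.span ℚ (Set.range fun j : J => ratRow v j) = ⊤) {w : κ → ℝ}
    (hJ : ∀ j ∈ J, ∃ n : ℤ, realPairing (v j) w - c j = n) {i : ι}
    (hi : ∃ n : ℤ, realPairing (v i) w - c i = n) : i ∈ J := by
  by_contra hiJ
  have hmem : ratRow v i ∈ Submodule.span ℚ (Set.range fun j : J => ratRow v j) :=
    hspan ▸ Submodule.mem_top
  obtain ⟨q, hq⟩ := (Submodule.mem_span_range_iff_exists_fun ℚ).1 hmem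
  choose n hn using fun j : J => hJ j j.2
  obtain ⟨n', hn'⟩ := hi
  have hw : ∑ j, (q j : ℝ) * realPairing (v j) w = realPairing (v i) w := by
    simp only [realPairing_apply, Finset.mul_sum]
    rw [Finset.sum_comm]
    refine Finset.sum_congr rfl fun l _ => ?_
    have := congrArg (Rat.cast : ℚ → ℝ) (congrFun hq l)
    simp only [ratRow, Finset.sum_apply, Pi.smul_apply, smul_eq_mul] at this
    push_cast at this
    rw [← this, Finset.sum_mul]
    exact Finset.sum_congr rfl fun j _ => by ring
  -- The relation has the coefficients `q` on `J`, -1 at `i` and 0 elsewhere; the entry -1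
  -- contradicts genericity.
  have hrel : (∑ l, ((if h : l ∈ J then q ⟨l, h⟩ else if l = i then -1 else 0 : ℚ) : ℝ) * c l) =
      ((n' - ∑ j, q j * n j : ℚ) : ℝ) := by
    have h1 : (∑ j : J, (q j : ℝ) * c j) - c i = n' - ∑ j, (q j : ℝ) * n j := by
      rw [← hn', ← hw]
      simp only [← hn, mul_sub, Finset.sum_sub_distrib]
      ring
    have h2 : (∑ l, ((if h : l ∈ J then q ⟨l, h⟩ else if l = i then -1 else 0 : ℚ) : ℝ) * c l) =
        (∑ j : J, (q j : ℝ) * c j) - c i := by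
      rw [← Finset.sum_add_sum_compl J, ← Finset.sum_coe_sort J, sub_eq_add_neg]
      congr 1
      · exact Finset.sum_congr rfl fun j _ => by simp
      · rw [Finset.sum_eq_single i]
        · simp [hiJ]
        · intro l hl hli
          simp [Finset.mem_compl.1 hl, hli]
        · intro h
          simp [hiJ] at h
    rw [h2, h1]
    push_cast
    rfl
  have := congrFun (hc _ _ hrel) i
  simp [hiJ] at this

/-- Such an `f` is the edge direction at the vertex along which only the `i`-th constraint of `J`
changes. -/
theorem exists_dual_row {ι κ : Type} [Fintype κ] {v : ι → κ → ℤ} {J : Finset ι}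
    (hcard : J.card = Fintype.card κ) (hli : LinearIndependent ℚ (fun j : J => ratRow v j))
    {i : ι} (hi : i ∈ J) :
    ∃ f : (κ → ℚ) →ₗ[ℚ] ℚ, f (ratRow v i) = 1 ∧ ∀ j ∈ J, j ≠ i → f (ratRow v j) = 0 := by
  set b := Module.Basis.mk hli
    (hli.span_eq_top_of_card_eq_finrank' (by simp [hcard])).ge with hb
  have hbj (j : J) : b j = ratRow v j := Module.Basis.mk_apply _ _ j
  refine ⟨b.coord ⟨i, hi⟩, ?_, fun j hj hji => ?_⟩
  · rw [← hbj ⟨i, hi⟩, Module.Basis.coord_apply, Module.Basis.repr_self, Finsupp.single_eq_same]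
  · rw [← hbj ⟨j, hj⟩, Module.Basis.coord_apply, Module.Basis.repr_self,
      Finsupp.single_eq_of_ne (by simpa using hji.symm)]

/-- The vertex minimizes `ξ` over the closed cell. At a minimum, the sign of `ξ` on each edge
direction decides whether the cell lies above or below the corresponding hyperplane. This sign
depends on `J` but not on `k`, so `k` can be recovered from `J` and `w`. -/
theorem exists_vertex {ι κ : Type} [Fintype ι] [Fintype κ] {v : ι → κ → ℤ}
    (hv : ∀ d : κ → ℝ, (∀ i, realPairing (v i) d = 0) → d = 0) {c : ι → ℝ}
    (hc : ∀ (q : ι → ℚ) (r : ℚ), ∑ i, (q i : ℝ) * c i = r → q = 0) {ξ : κ → ℝ}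
    (hξ : ∀ (q : κ → ℚ) (r : ℚ), ∑ l, (q l : ℝ) * ξ l = r → q = 0) {k : ι → ℤ}
    (hne : (cellClosure v c k).Nonempty) :
    ∃ J : Finset ι, J.card = Fintype.card κ ∧ LinearIndependent ℚ (fun j : J => ratRow v j) ∧
      ∃ w : κ → ℝ, (∀ i ∉ J, ⌊realPairing (v i) w - c i⌋ = k i) ∧
        ∀ i ∈ J, ∀ f : (κ → ℚ) →ₗ[ℚ] ℚ, f (ratRow v i) = 1 →
          (∀ j ∈ J, j ≠ i → f (ratRow v j) = 0) →
          realPairing (v i) w - c i =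
            k i + if 0 < ∑ l, dualVector f l * ξ l then (0 : ℝ) else 1 := by
  obtain ⟨w, hw, hmin⟩ := (isCompact_cellClosure hv c k).exists_isMinOn hne
    (f := fun x => ∑ l, x l * ξ l) (by fun_prop)
  set A : Set ι := {i | ∃ n : ℤ, realPairing (v i) w - c i = n} with hA
  have hlowA (i) (h : realPairing (v i) w - c i = k i) : i ∈ A := ⟨k i, h⟩
  have hupA (i) (h : realPairing (v i) w - c i = k i + 1) : i ∈ A :=
    ⟨k i + 1, by rw [h]; push_cast; rfl⟩
  have hspan : Submodule.span ℚ (ratRow v '' A) = ⊤ := by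
    -- Otherwise a rational direction is tangent to all active hyperplanes. Both it and its negative
    -- are feasible, so `ξ` vanishes on it, against genericity.
    by_contra hlt
    obtain ⟨f, hf, hker⟩ := Submodule.exists_le_ker_of_lt_top _ (lt_top_iff_ne_top.2 hlt)
    have hz (i) (hi : i ∈ A) : realPairing (v i) (dualVector f) = 0 := by
      rw [realPairing_dualVector]
      exact_mod_cast hker (Submodule.subset_span ⟨i, hi, rfl⟩)
    have h1 := nonneg_of_isMinOn_cellClosure hw hmin (d := dualVector f)
      (fun i hi => (hz i (hlowA i hi)).ge) (fun i hi => (hz i (hupA i hi)).le)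
    have h2 := nonneg_of_isMinOn_cellClosure hw hmin (d := -dualVector f)
      (fun i hi => by rw [map_neg, hz i (hlowA i hi), neg_zero])
      (fun i hi => by rw [map_neg, hz i (hupA i hi), neg_zero])
    simp only [Pi.neg_apply, neg_mul, Finset.sum_neg_distrib] at h2
    exact sum_mul_dualVector_ne_zero hξ hf (by linarith)
  obtain ⟨J, hJA, hcard, hli⟩ := exists_linearIndependent_rows hspan
  have hJspan : Submodule.span ℚ (Set.range fun j : J => ratRow v j) = ⊤ :=
    hli.span_eq_top_of_card_eq_finrank' (by simp [hcard])
  have hAJ (i) (hi : i ∈ A) : i ∈ J := eq_of_active hc hJspan (fun j hj => hJA hj) hi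
  refine ⟨J, hcard, hli, w, fun i hi => ?_, fun i hi f hfi hfj => ?_⟩
  · refine Int.floor_eq_iff.2 ⟨(hw i).1, lt_of_le_of_ne (hw i).2 fun h => hi (hAJ i (hupA i h))⟩
  · have hpi : realPairing (v i) (dualVector f) = 1 := by
      rw [realPairing_dualVector]
      exact_mod_cast hfi
    have hpj (j) (hj : j ∈ A) (hji : j ≠ i) : realPairing (v j) (dualVector f) = 0 := by
      rw [realPairing_dualVector]
      exact_mod_cast hfj j (hAJ j hj) hji
    have hf0 : f ≠ 0 := by
      rintro rfl
      simp at hfi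
    have hint : realPairing (v i) w - c i = k i ∨ realPairing (v i) w - c i = k i + 1 := by
      obtain ⟨n, hn⟩ := hJA hi
      have h1 := (hw i).1
      have h2 := (hw i).2
      rw [hn] at h1 h2 ⊢
      have h1 : k i ≤ n := by exact_mod_cast h1
      have h2 : n ≤ k i + 1 := by exact_mod_cast h2
      rcases h1.eq_or_lt with h | h
      · exact Or.inl (by rw [h])
      · exact Or.inr (by exact_mod_cast le_antisymm h2 h)
    split_ifs with hpos
    · rw [add_zero]
      refine hint.resolve_right fun h => ?_
      have := nonneg_of_isMinOn_cellClosure hw hmin (d := -dualVector f)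
        (fun j hj => by
          rw [map_neg, hpj j (hlowA j hj) (by rintro rfl; linarith), neg_zero])
        (fun j hj => by
          rcases eq_or_ne j i with rfl | hji
          · rw [map_neg, hpi]; norm_num
          · rw [map_neg, hpj j (hupA j hj) hji, neg_zero])
      simp only [Pi.neg_apply, neg_mul, Finset.sum_neg_distrib] at this
      linarith
    · refine hint.resolve_left fun h => ?_
      have := nonneg_of_isMinOn_cellClosure hw hmin (d := dualVector f)
        (fun j hj => by
          rcases eq_or_ne j i with rfl | hji
          · rw [hpi]; norm_num
          · rw [hpj j (hlowA j hj) hji])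
        (fun j hj => by
          rw [hpj j (hupA j hj) (by rintro rfl; linarith)])
      exact sum_mul_dualVector_ne_zero hξ hf0 (le_antisymm (not_lt.1 hpos) this)

/-! ### Counting cells by maximal minors -/

theorem absDet_nonneg {ι κ : Type} [Fintype ι] (M : Matrix ι κ ℤ) : 0 ≤ absDet M := by
  unfold absDet
  split_ifs
  · exact abs_nonneg _
  · exact le_rfl

theorem absDet_ne_zero_of_linearIndependent {ι κ : Type} [Fintype ι] [Fintype κ]
    {v : ι → κ → ℤ} (hcard : Fintype.card ι = Fintype.card κ)
    (hli : LinearIndependent ℚ (ratRow v)) : absDet (Matrix.of v) ≠ 0 := by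
  obtain e := Fintype.equivOfCardEq hcard
  rw [absDet_eq _ e, abs_ne_zero]
  have hli' : LinearIndependent ℚ (((Matrix.of v).submatrix id e).map (Int.cast : ℤ → ℚ)).row := by
    exact hli.map' (LinearEquiv.funCongrLeft ℚ ℚ e).toLinearMap (LinearEquiv.ker _)
  have hu := Matrix.linearIndependent_rows_iff_isUnit.1 hli'
  have := (Matrix.isUnit_iff_isUnit_det _).1 hu
  intro h
  have h' : (((Matrix.of v).submatrix id e).map (Int.cast : ℤ → ℚ)).det = 0 := by
    have := RingHom.map_det (Int.castRingHom ℚ) ((Matrix.of v).submatrix id e)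
    rw [h, map_zero] at this
    exact this.symm
  exact this.ne_zero h'

/-- Points of pairwise different cells of a toric arrangement are at most as many as the sum of the
absolute values of the maximal minors of the matrix of normals. -/
theorem card_le_sum_absDet {ι κ S : Type} [Fintype ι] [Fintype κ] [Fintype S] {v : ι → κ → ℤ}
    (hv : ∀ d : κ → ℝ, (∀ i, realPairing (v i) d = 0) → d = 0) (x : S → κ → ℝ)
    (hx : ∀ s, torusProj (x s) ∈ toricComplement v)
    (hinj : ∀ s t, SameCell v (x s) (x t) → s = t) :
    (Fintype.card S : ℤ) ≤ ∑ J ∈ Finset.powersetCard (Fintype.card κ) (Finset.univ : Finset ι),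
      absDet (Matrix.of fun (t : {t // t ∈ J}) (l : κ) => v t.1 l) := by
  -- `δ` is smaller than the distance of every value at the given points from the integers, so
  -- shifts below `δ` leave each point in a cell with the same label.
  obtain ⟨δ, hδ, hδ0⟩ : ∃ δ : ℝ, (∀ s i, δ < Int.fract (realPairing (v i) (x s)) ∧
      δ < 1 - Int.fract (realPairing (v i) (x s))) ∧ 0 < δ := by
    have hev : ∀ᶠ δ : ℝ in nhdsWithin 0 (Set.Ioi 0), ∀ s i,
        δ < Int.fract (realPairing (v i) (x s)) ∧
          δ < 1 - Int.fract (realPairing (v i) (x s)) := by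
      simp only [Filter.eventually_all]
      intro s i
      have h1 := torusProj_mem_toricComplement.1 (hx s) i
      have h2 := Int.fract_lt_one (realPairing (v i) (x s))
      exact ((eventually_lt_nhds (sub_pos.2 h1)).and
        (eventually_lt_nhds (sub_pos.2 h2))).filter_mono nhdsWithin_le_nhds
    exact (hev.and self_mem_nhdsWithin).exists
  obtain ⟨c, hcδ, hc⟩ := exists_small_rationally_independent ι hδ0
  obtain ⟨ξ, -, hξ⟩ := exists_small_rationally_independent κ one_pos
  set k : S → ι → ℤ := fun s i => ⌊realPairing (v i) (x s)⌋ with hk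
  have hne (s) : (cellClosure v c (k s)).Nonempty := by
    refine ⟨x s, fun i => ?_⟩
    have h1 := hδ s i
    have h2 := abs_lt.1 (hcδ i)
    rw [Int.fract] at h1
    constructor <;> simp only [hk] <;> linarith
  choose J hJcard hJli w hw hwJ using fun s => exists_vertex hv hc hξ (hne s)
  -- Cells sharing the index set `J s₀` inject into the solutions of its square system. If two
  -- vertices differ by a lattice vector, their labels differ accordingly: off `J s₀` by taking
  -- floors, on `J s₀` because the side is the same for both cells.
  have hfib (s₀ : S) : Function.Injective fun s : {s // J s = J s₀} =>
      (⟨torusProj (w s.1), fun t => by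
        have ht : t.1 ∈ J s.1 := by rw [s.2]; exact t.2
        obtain ⟨f, hf1, hf0⟩ := exists_dual_row (hJcard s.1) (hJli s.1) ht
        have h := hwJ s.1 t.1 ht f hf1 hf0
        rw [← coe_realPairing, ← sub_eq_zero, ← AddCircle.coe_sub, AddCircle.coe_eq_zero_iff, h]
        split_ifs
        · exact ⟨k s.1 t.1, by simp⟩
        · exact ⟨k s.1 t.1 + 1, by simp⟩⟩ :
        {y : κ → UnitAddCircle // ∀ t : {t // t ∈ J s₀},
          ∑ l, v t.1 l • y l = ((c t.1 : ℝ) : UnitAddCircle)}) := by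
    rintro ⟨s, hs⟩ ⟨t, ht⟩ hst
    obtain ⟨z, hz⟩ := torusProj_eq_iff.1 (congrArg Subtype.val hst)
    simp only at hz
    refine Subtype.ext (hinj s t ⟨z, fun i => ?_⟩)
    change k s i = k t i + _
    have hzi : realPairing (v i) (w s) - c i =
        realPairing (v i) (w t) - c i + ((∑ l, v i l * z l : ℤ) : ℝ) := by
      rw [hz, map_add, realPairing_intCast]
      ring
    by_cases hi : i ∈ J s₀
    · obtain ⟨f, hf1, hf0⟩ := exists_dual_row (hJcard s₀) (hJli s₀) hi
      have h1 := hwJ s i (hs.symm ▸ hi) f hf1 fun j hj => hf0 j (hs ▸ hj)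
      have h2 := hwJ t i (ht.symm ▸ hi) f hf1 fun j hj => hf0 j (ht ▸ hj)
      have h3 : (k s i : ℝ) = k t i + ((∑ l, v i l * z l : ℤ) : ℝ) := by linarith
      exact_mod_cast h3
    · rw [← hw s i (hs ▸ hi), ← hw t i (ht ▸ hi), hzi, Int.floor_add_intCast]
  rw [← Finset.card_univ, Finset.card_eq_sum_card_fiberwise (f := J)
    (t := Finset.powersetCard (Fintype.card κ) Finset.univ)
    (fun s _ => by simp [Finset.mem_powersetCard, hJcard])]
  push_cast
  refine Finset.sum_le_sum fun K _ => ?_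
  rcases Finset.eq_empty_or_nonempty {s : S | J s = K} with h | ⟨s₀, hs₀⟩
  · rw [h]
    simpa using absDet_nonneg _
  · obtain rfl : J s₀ = K := by simpa using hs₀
    have hdet : absDet (Matrix.of fun (t : {t // t ∈ J s₀}) (l : κ) => v t.1 l) ≠ 0 :=
      absDet_ne_zero_of_linearIndependent (by simp [hJcard]) (hJli s₀)
    obtain ⟨hfin, hle⟩ := card_solutions_le_absDet _ hdet
      (fun t => ((c t.1 : ℝ) : UnitAddCircle))
    refine le_trans ?_ hle
    have := @Nat.card_le_card_of_injective _ _ hfin _ (hfib s₀)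
    rw [Nat.card_eq_fintype_card, Fintype.card_subtype] at this
    exact_mod_cast this

theorem exists_lift {ι κ : Type} [Fintype κ] {v : ι → κ → ℤ}
    (C : ConnectedComponents (toricComplement v)) :
    ∃ (x : κ → ℝ) (hx : torusProj x ∈ toricComplement v),
      ((⟨torusProj x, hx⟩ : toricComplement v) : ConnectedComponents (toricComplement v)) = C := by
  obtain ⟨p, rfl⟩ := ConnectedComponents.surjective_coe C
  obtain ⟨x, hx⟩ := isOpenQuotientMap_torusProj.surjective p.1
  exact ⟨x, hx ▸ p.2, congrArg _ (Subtype.ext hx)⟩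

/-- Stated for finite sets of flats because a uniform bound on these is what proves finiteness in
`finite_topFlats`. -/
theorem card_finset_topFlats_le {ι κ : Type} [Fintype ι] [Fintype κ] {v : ι → κ → ℤ}
    (hv : ∀ d : κ → ℝ, (∀ i, realPairing (v i) d = 0) → d = 0) (T : Finset (TopFlats v 0)) :
    (T.card : ℤ) ≤ ∑ J ∈ Finset.powersetCard (Fintype.card κ) (Finset.univ : Finset ι),
      absDet (Matrix.of fun (t : {t // t ∈ J}) (l : κ) => v t.1 l) := by
  choose x hx hxC using fun C : T => exists_lift C.1
  rw [← Fintype.card_coe]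
  exact card_le_sum_absDet hv x hx fun s t hst => Subtype.ext <|
    (hxC s).symm.trans ((mk_eq_of_sameCell rfl rfl hst).trans (hxC t))

theorem finite_topFlats {ι κ : Type} [Fintype ι] [Fintype κ] {v : ι → κ → ℤ}
    (hv : ∀ d : κ → ℝ, (∀ i, realPairing (v i) d = 0) → d = 0) : Finite (TopFlats v 0) := by
  by_contra h
  have := not_finite_iff_infinite.1 h
  set B := ∑ J ∈ Finset.powersetCard (Fintype.card κ) (Finset.univ : Finset ι),
    absDet (Matrix.of fun (t : {t // t ∈ J}) (l : κ) => v t.1 l)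
  obtain ⟨T, hT⟩ := Infinite.exists_subset_card_eq (TopFlats v 0) (B.toNat + 1)
  have := card_finset_topFlats_le hv T
  rw [hT] at this
  have h2 := Int.self_le_toNat B
  push_cast at this
  omega

theorem card_topFlats_le {ι κ : Type} [Fintype ι] [Fintype κ] {v : ι → κ → ℤ}
    (hv : ∀ d : κ → ℝ, (∀ i, realPairing (v i) d = 0) → d = 0) :
    (Nat.card (TopFlats v 0) : ℤ) ≤
      ∑ J ∈ Finset.powersetCard (Fintype.card κ) (Finset.univ : Finset ι),
        absDet (Matrix.of fun (t : {t // t ∈ J}) (l : κ) => v t.1 l) := by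
  have := finite_topFlats hv
  have := Fintype.ofFinite (TopFlats v 0)
  rw [Nat.card_eq_fintype_card, ← Finset.card_univ]
  exact card_finset_topFlats_le hv _

/-! ### Free action of translations on the regions -/

/-- Translations that preserve all the hyperplanes of an essential toric arrangement act freely on
its regions. -/
theorem eq_of_mk_add_eq {ι κ : Type} [Finite ι] [Fintype κ] {v : ι → κ → ℤ}
    (hv : ∀ d : κ → ℝ, (∀ i, realPairing (v i) d = 0) → d = 0) {p σ τ : κ → UnitAddCircle}
    (hσ : ∀ i, ∑ l, v i l • σ l = 0) (hτ : ∀ i, ∑ l, v i l • τ l = 0)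
    (hpσ : p + σ ∈ toricComplement v) (hpτ : p + τ ∈ toricComplement v)
    (h : ((⟨p + σ, hpσ⟩ : toricComplement v) : ConnectedComponents (toricComplement v)) =
      (⟨p + τ, hpτ⟩ : toricComplement v)) : σ = τ := by
  obtain ⟨x, rfl⟩ := isOpenQuotientMap_torusProj.surjective p
  obtain ⟨y, rfl⟩ := isOpenQuotientMap_torusProj.surjective σ
  obtain ⟨w, rfl⟩ := isOpenQuotientMap_torusProj.surjective τ
  simp only [← coe_realPairing, AddCircle.coe_eq_zero_iff, zsmul_eq_mul, mul_one] at hσ hτ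
  choose n hn using hσ
  choose k hk using hτ
  obtain ⟨z, hz⟩ := sameCell_of_mk_eq h (torusProj_add x y) (torusProj_add x w)
  refine torusProj_eq_iff.2 ⟨z, ?_⟩
  rw [← sub_eq_zero]
  refine hv _ fun i => ?_
  have hi := hz i
  rw [map_add, map_add, ← hn, ← hk, Int.floor_add_intCast, Int.floor_add_intCast] at hi
  have hi : n i = k i + ∑ l, v i l * z l := by linarith
  rw [map_sub, map_add, realPairing_intCast, ← hn, ← hk, hi]
  push_cast
  ring

/-! ### Cross products and triple intersections -/

theorem exists_sum_mul_eq_finset_gcd {ι : Type} (s : Finset ι) (f : ι → ℤ) :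
    ∃ z : ι → ℤ, ∑ i ∈ s, f i * z i = s.gcd f := by
  induction s using Finset.induction_on with
  | empty => exact ⟨0, by simp⟩
  | insert i s hi ih =>
    obtain ⟨z, hz⟩ := ih
    obtain ⟨x, y, hxy⟩ := exists_gcd_eq_mul_add_mul (f i) (s.gcd f)
    refine ⟨fun j => if j = i then x else y * z j, ?_⟩
    refine Eq.trans ?_ (Finset.gcd_insert.trans hxy).symm
    rw [Finset.sum_insert hi, ← hz, Finset.sum_mul]
    beta_reduce
    rw [if_pos rfl]
    congr 1
    refine Finset.sum_congr rfl fun j hj => ?_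
    rw [if_neg (ne_of_mem_of_not_mem hj hi)]
    ring

theorem gcd_mul_primitivePart (w : Fin 3 → ℤ) (s : Fin 3) :
    Finset.univ.gcd w * primitivePart w s = w s :=
  Int.mul_ediv_cancel' (Finset.gcd_dvd (Finset.mem_univ s))

theorem exists_sum_primitivePart_mul_eq_one {w : Fin 3 → ℤ} (hw : w ≠ 0) :
    ∃ z : Fin 3 → ℤ, ∑ s, primitivePart w s * z s = 1 := by
  obtain ⟨z, hz⟩ := exists_sum_mul_eq_finset_gcd Finset.univ w
  have hG : Finset.univ.gcd w ≠ 0 := fun h =>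
    hw (funext fun s => Finset.gcd_eq_zero_iff.1 h s (Finset.mem_univ s))
  refine ⟨z, mul_left_cancel₀ hG ?_⟩
  simp only [Finset.mul_sum, ← mul_assoc, gcd_mul_primitivePart, hz, mul_one]

theorem det₂_eq (u v : Fin 2 → ℤ) : det₂ u v = u 0 * v 1 - u 1 * v 0 := by
  simp [det₂, Matrix.det_fin_two]

/-- The cross product of the columns of the matrix with rows `A`. -/
def columnCross (A : Fin 3 → Fin 2 → ℤ) : Fin 3 → ℤ :=
  (fun s => A s 0) ⨯₃ (fun s => A s 1)

theorem columnCross_eq (A : Fin 3 → Fin 2 → ℤ) :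
    columnCross A = ![det₂ (A 1) (A 2), det₂ (A 2) (A 0), det₂ (A 0) (A 1)] := by
  simp only [columnCross, cross_apply, det₂_eq]
  ext s
  fin_cases s <;> simp <;> ring

theorem columnCross_ne_zero {A : Fin 3 → Fin 2 → ℤ} (h : ∃ r s, det₂ (A r) (A s) ≠ 0) :
    columnCross A ≠ 0 := by
  intro h0
  rw [columnCross_eq] at h0
  have h1 := congrFun h0 0
  have h2 := congrFun h0 1
  have h3 := congrFun h0 2
  simp [det₂_eq] at h1 h2 h3
  obtain ⟨r, s, hrs⟩ := h
  refine hrs ?_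
  rw [det₂_eq]
  fin_cases r <;> fin_cases s <;> simp <;> linarith

theorem det₂_eq_zero_of_columnCross_eq_zero {A : Fin 3 → Fin 2 → ℤ} {s r r' : Fin 3}
    (h : columnCross A s = 0) (hr : r ≠ s) (hr' : r' ≠ s) : det₂ (A r) (A r') = 0 := by
  rw [columnCross_eq] at h
  fin_cases s <;> simp [det₂_eq] at h <;> fin_cases r <;> fin_cases r' <;>
    simp [det₂_eq] at hr hr' ⊢ <;> linarith

theorem sum_columnCross_mul (A : Fin 3 → Fin 2 → ℤ) (l : Fin 2) :
    ∑ s, columnCross A s * A s l = 0 := by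
  rw [columnCross_eq]
  simp only [det₂_eq]
  fin_cases l <;> simp [Fin.sum_univ_three] <;> ring

theorem sum_primitivePart_columnCross_mul {A : Fin 3 → Fin 2 → ℤ} (h : columnCross A ≠ 0)
    (l : Fin 2) : ∑ s, primitivePart (columnCross A) s * A s l = 0 := by
  have hG : Finset.univ.gcd (columnCross A) ≠ 0 := fun h' =>
    h (funext fun s => Finset.gcd_eq_zero_iff.1 h' s (Finset.mem_univ s))
  refine mul_left_cancel₀ hG ?_
  simp only [Finset.mul_sum, ← mul_assoc, gcd_mul_primitivePart, sum_columnCross_mul, mul_zero]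

theorem exists_realPairing_eq_pair {u v : Fin 2 → ℤ} (h : det₂ u v ≠ 0) (p q : ℝ) :
    ∃ x : Fin 2 → ℝ, realPairing u x = p ∧ realPairing v x = q := by
  have hD : ((u 0 : ℝ) * v 1 - u 1 * v 0) ≠ 0 := by
    rw [det₂_eq] at h
    exact_mod_cast h
  refine ⟨![(p * v 1 - q * u 1) / (u 0 * v 1 - u 1 * v 0),
    (u 0 * q - v 0 * p) / (u 0 * v 1 - u 1 * v 0)], ?_, ?_⟩ <;>
  · simp only [realPairing_apply, Fin.sum_univ_two, Matrix.cons_val_zero, Matrix.cons_val_one]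
    rw [← mul_div_assoc, ← mul_div_assoc, ← add_div, div_eq_iff hD]
    ring

/-- Some entry of the cross product, a 2 × 2 minor, is nonzero. Solve the two equations of that
minor; the linear relation then forces the third. -/
theorem exists_realPairing_eq_triple {A : Fin 3 → Fin 2 → ℤ} (hA : columnCross A ≠ 0)
    {β : Fin 3 → ℝ} (hβ : ∑ s, (columnCross A s : ℝ) * β s = 0) :
    ∃ x : Fin 2 → ℝ, ∀ s, realPairing (A s) x = β s := by
  have key (x : Fin 2 → ℝ) : ∑ s, (columnCross A s : ℝ) * (realPairing (A s) x - β s) = 0 := by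
    simp only [mul_sub, Finset.sum_sub_distrib, hβ, realPairing_apply, Finset.mul_sum,
      ← mul_assoc]
    rw [Finset.sum_comm, sub_zero]
    refine Finset.sum_eq_zero fun l _ => ?_
    rw [← Finset.sum_mul]
    have := congrArg (Int.cast : ℤ → ℝ) (sum_columnCross_mul A l)
    push_cast at this
    rw [this, zero_mul]
  have hcc := columnCross_eq A
  obtain ⟨s, hs⟩ := Function.ne_iff.1 hA
  simp only [Pi.zero_apply] at hs
  have hs' : (columnCross A s : ℝ) ≠ 0 := by exact_mod_cast hs
  have h0 := congrFun hcc 0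
  have h1 := congrFun hcc 1
  have h2 := congrFun hcc 2
  simp only [Matrix.cons_val_zero, Matrix.cons_val_one, Matrix.cons_val] at h0 h1 h2
  simp only [Fin.sum_univ_three] at key
  fin_cases s
  · obtain ⟨x, hx1, hx2⟩ := exists_realPairing_eq_pair (h0 ▸ hs) (β 1) (β 2)
    have h := key x
    simp only [hx1, hx2, sub_self, mul_zero, add_zero] at h
    exact ⟨x, fun s => by
      fin_cases s
      exacts [sub_eq_zero.1 ((mul_eq_zero.1 h).resolve_left hs'), hx1, hx2]⟩
  · obtain ⟨x, hx2, hx0⟩ := exists_realPairing_eq_pair (h1 ▸ hs) (β 2) (β 0)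
    have h := key x
    simp only [hx0, hx2, sub_self, mul_zero, add_zero, zero_add] at h
    exact ⟨x, fun s => by
      fin_cases s
      exacts [hx0, sub_eq_zero.1 ((mul_eq_zero.1 h).resolve_left hs'), hx2]⟩
  · obtain ⟨x, hx0, hx1⟩ := exists_realPairing_eq_pair (h2 ▸ hs) (β 0) (β 1)
    have h := key x
    simp only [hx0, hx1, sub_self, mul_zero, zero_add] at h
    exact ⟨x, fun s => by
      fin_cases s
      exacts [hx0, hx1, sub_eq_zero.1 ((mul_eq_zero.1 h).resolve_left hs')]⟩

theorem sum_smul_sum_smul {ι κ : Type} [Fintype ι] [Fintype κ] {n : ι → ℤ} {A : ι → κ → ℤ}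
    (h : ∀ l, ∑ s, n s * A s l = 0) (x : κ → UnitAddCircle) :
    ∑ s, n s • ∑ l, A s l • x l = 0 := by
  simp only [Finset.smul_sum, ← mul_smul]
  rw [Finset.sum_comm]
  simp only [← Finset.sum_smul, h, zero_smul, Finset.sum_const_zero]

/-- Three toric lines with spanning normals have a common point if and only if their intercepts
are annihilated by the primitive cross product. -/
theorem exists_common_point_iff {A : Fin 3 → Fin 2 → ℤ} (hA : columnCross A ≠ 0)
    (b : Fin 3 → UnitAddCircle) :
    (∃ x : Fin 2 → UnitAddCircle, ∀ s, ∑ l, A s l • x l = b s) ↔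
      ∑ s, primitivePart (columnCross A) s • b s = 0 := by
  constructor
  · rintro ⟨x, hx⟩
    simp only [← hx]
    exact sum_smul_sum_smul (sum_primitivePart_columnCross_mul hA) x
  · intro h
    obtain ⟨β, rfl⟩ := isOpenQuotientMap_torusProj.surjective b
    rw [← coe_realPairing, AddCircle.coe_eq_zero_iff] at h
    obtain ⟨q, hq⟩ := h
    rw [zsmul_eq_mul, mul_one] at hq
    obtain ⟨z, hz⟩ := exists_sum_primitivePart_mul_eq_one hA
    -- The lift pairs with the primitive normal to the integer `q`. Since `z` pairs to 1, shifting
    -- by `-q * z` makes the pairing exactly zero without changing the torus point; this is where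
    -- primitivity enters.
    set β' : Fin 3 → ℝ := β + fun s => ((-q * z s : ℤ) : ℝ) with hβ'
    have h0 : realPairing (primitivePart (columnCross A)) β' = 0 := by
      rw [hβ', map_add, realPairing_intCast, ← hq]
      have : ∑ s, primitivePart (columnCross A) s * (-q * z s) = -q := by
        simp only [mul_left_comm _ (-q), ← Finset.mul_sum, hz, mul_one]
      rw [this]
      push_cast
      ring
    obtain ⟨x, hx⟩ := exists_realPairing_eq_triple hA (β := β') (by
      have : ∀ s, (columnCross A s : ℝ) * β' s = ((Finset.univ.gcd (columnCross A) : ℤ) : ℝ) *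
          (primitivePart (columnCross A) s * β' s) := fun s => by
        rw [← mul_assoc, ← Int.cast_mul, gcd_mul_primitivePart]
      simp only [this, ← Finset.mul_sum]
      rw [← realPairing_apply, h0, mul_zero])
    refine ⟨torusProj x, fun s => ?_⟩
    rw [← coe_realPairing, hx]
    exact congrFun (torusProj_eq_iff.2 ⟨_, rfl⟩ : torusProj β' = torusProj β) s

theorem tripleNormal_eq {m : ℕ} (a : Fin m → Fin 2 → ℤ) (t : SpanningTriple a) :
    tripleNormal a t = primitivePart (columnCross fun s => a (t.1 s)) := rfl

theorem sum_extendedNormal_smul {m : ℕ} {M : Type} [AddCommGroup M] (a : Fin m → Fin 2 → ℤ)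
    (t : SpanningTriple a) (b : Fin m → M) :
    ∑ l, extendedNormal a t l • b l = ∑ s, tripleNormal a t s • b (t.1 s) := by
  symm
  refine Fintype.sum_of_injective t.1 t.1.injective _ _ (fun l hl => ?_) fun s => ?_
  · rw [extendedNormal, Function.extend_apply' _ _ _ (by simpa using hl)]
    simp
  · rw [extendedNormal, t.1.injective.extend_apply]

theorem exists_orderEmbedding_of_ne {m : ℕ} {i j k : Fin m} (hij : i ≠ j) (hik : i ≠ k)
    (hjk : j ≠ k) : ∃ t : Fin 3 ↪o Fin m, Set.range t = {i, j, k} := by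
  have hc : ({i, j, k} : Finset (Fin m)).card = 3 := Finset.card_eq_three.2
    ⟨i, j, k, hij, hik, hjk, rfl⟩
  exact ⟨Finset.orderEmbOfFin _ hc, by rw [Finset.range_orderEmbOfFin]; simp⟩

theorem exists_spanningTriple {m : ℕ} {a : Fin m → Fin 2 → ℤ} {i j k : Fin m} (hij : i ≠ j)
    (hik : i ≠ k) (hjk : j ≠ k) (h : det₂ (a i) (a j) ≠ 0) :
    ∃ t : SpanningTriple a, Set.range t.1 = {i, j, k} := by
  obtain ⟨t, ht⟩ := exists_orderEmbedding_of_ne hij hik hjk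
  obtain ⟨r, hr⟩ : i ∈ Set.range t := by simp [ht]
  obtain ⟨s, hs⟩ : j ∈ Set.range t := by simp [ht]
  exact ⟨⟨t, r, s, by rwa [hr, hs]⟩, ht⟩

theorem det₂_ne_zero_or {g h u : Fin 2 → ℤ} (hgh : det₂ g h ≠ 0) (hu : u ≠ 0) :
    det₂ u g ≠ 0 ∨ det₂ u h ≠ 0 := by
  by_contra! hc
  obtain ⟨h1, h2⟩ := hc
  rw [det₂_eq] at h1 h2 hgh
  refine hu (funext fun s => ?_)
  have h3 : u 0 * (g 0 * h 1 - g 1 * h 0) = 0 := by linear_combination g 0 * h2 - h 0 * h1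
  have h4 : u 1 * (g 0 * h 1 - g 1 * h 0) = 0 := by linear_combination g 1 * h2 - h 1 * h1
  fin_cases s
  exacts [(mul_eq_zero.1 h3).resolve_right hgh, (mul_eq_zero.1 h4).resolve_right hgh]

/-- An arrangement of toric lines has no triple intersection if and only if its vector of
intercepts lies on none of the toric hyperplanes given by the spanning triples. -/
theorem noTriple_iff {m : ℕ} {a : Fin m → Fin 2 → ℤ} (ha : ∀ i, a i ≠ 0) {g h : Fin m}
    (hgh : det₂ (a g) (a h) ≠ 0) {b : Fin m → UnitAddCircle} :
    NoTriple a b ↔ ∀ t : SpanningTriple a, ∑ l, extendedNormal a t l • b l ≠ 0 := by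
  have hiff (t : SpanningTriple a) : ∑ l, extendedNormal a t l • b l = 0 ↔
      ∃ x : Fin 2 → UnitAddCircle, ∀ i ∈ Set.range t.1, x ∈ toricHyperplane (a i) (b i) := by
    rw [sum_extendedNormal_smul, tripleNormal_eq,
      ← exists_common_point_iff (columnCross_ne_zero t.2) fun s => b (t.1 s)]
    simp [toricHyperplane]
  constructor
  · intro hb t ht
    obtain ⟨x, hx⟩ := (hiff t).1 ht
    have hinj := t.1.injective
    have := hb (t.1 0) (t.1 1) (t.1 2) (hinj.ne (by decide)) (hinj.ne (by decide))
      (hinj.ne (by decide))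
    exact Set.eq_empty_iff_forall_notMem.1 this x ⟨⟨hx _ ⟨0, rfl⟩, hx _ ⟨1, rfl⟩⟩, hx _ ⟨2, rfl⟩⟩
  · intro hb i j k hij hik hjk
    refine Set.eq_empty_iff_forall_notMem.2 ?_
    rintro x ⟨⟨hxi, hxj⟩, hxk⟩
    have spanning {i j k : Fin m} {x : Fin 2 → UnitAddCircle} (hij : i ≠ j) (hik : i ≠ k)
        (hjk : j ≠ k) (hd : det₂ (a i) (a j) ≠ 0) (hxi : x ∈ toricHyperplane (a i) (b i))
        (hxj : x ∈ toricHyperplane (a j) (b j)) (hxk : x ∈ toricHyperplane (a k) (b k)) :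
        False := by
      obtain ⟨t, ht⟩ := exists_spanningTriple hij hik hjk hd
      refine hb t ((hiff t).2 ⟨x, fun l hl => ?_⟩)
      rw [ht] at hl
      rcases hl with rfl | rfl | rfl <;> assumption
    -- If lines `i` and `j` are parallel, slide their common point along their direction until it
    -- meets a line `l` transverse to both. Then `i`, `l`, `j` is a spanning triple with a common
    -- point.
    by_cases hd : det₂ (a i) (a j) = 0
    · obtain ⟨l, hl⟩ : ∃ l, det₂ (a i) (a l) ≠ 0 :=
        (det₂_ne_zero_or hgh (ha i)).elim (fun h => ⟨g, h⟩) fun h' => ⟨h, h'⟩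
      have hil : i ≠ l := by
        rintro rfl
        exact hl (by rw [det₂_eq]; ring)
      have hlj : l ≠ j := by
        rintro rfl
        exact hl hd
      obtain ⟨y, rfl⟩ := isOpenQuotientMap_torusProj.surjective x
      obtain ⟨β, hβ⟩ := QuotientAddGroup.mk_surjective (b l)
      obtain ⟨w, hwi, hwl⟩ := exists_realPairing_eq_pair hl 0 (β - realPairing (a l) y)
      have hwj : realPairing (a j) w = 0 := by
        rw [realPairing_apply, Fin.sum_univ_two] at hwi ⊢
        have hd' : (a i 0 : ℝ) * a j 1 - a i 1 * a j 0 = 0 := by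
          rw [det₂_eq] at hd
          exact_mod_cast hd
        obtain h0 | h0 : a i 0 ≠ 0 ∨ a i 1 ≠ 0 := by
          by_contra! hc
          exact ha i (funext fun s => by fin_cases s; exacts [hc.1, hc.2])
        · have h0 : (a i 0 : ℝ) ≠ 0 := by exact_mod_cast h0
          refine (mul_eq_zero.1 (?_ : (a i 0 : ℝ) * _ = 0)).resolve_left h0
          linear_combination (a j 0 : ℝ) * hwi + w 1 * hd'
        · have h0 : (a i 1 : ℝ) ≠ 0 := by exact_mod_cast h0
          refine (mul_eq_zero.1 (?_ : (a i 1 : ℝ) * _ = 0)).resolve_left h0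
          linear_combination (a j 1 : ℝ) * hwi - w 0 * hd'
      have hmem (n : Fin m) : torusProj (y + w) ∈ toricHyperplane (a n) (b n) ↔
          ((realPairing (a n) y + realPairing (a n) w : ℝ) : UnitAddCircle) = b n := by
        rw [← map_add, coe_realPairing]
        rfl
      have hmem' (n : Fin m) : torusProj y ∈ toricHyperplane (a n) (b n) ↔
          ((realPairing (a n) y : ℝ) : UnitAddCircle) = b n := by
        rw [coe_realPairing]
        rfl
      refine spanning hil hij hlj hl (x := torusProj (y + w)) ?_ ?_ ?_
      · rw [hmem, hwi, add_zero, ← hmem']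
        exact hxi
      · rw [hmem, hwl, add_sub_cancel]
        exact hβ
      · rw [hmem, hwj, add_zero, ← hmem']
        exact hxj
    · exact spanning hij hik hjk hd hxi hxj hxk

/-! ### Moving the origin and fixing two lines -/

/-- The intercepts of the lines through the point `x` of the torus. -/
def interceptsThrough {m : ℕ} (a : Fin m → Fin 2 → ℤ) (x : Fin 2 → UnitAddCircle) :
    Fin m → UnitAddCircle :=
  fun i => ∑ l, a i l • x l

theorem sum_extendedNormal_smul_interceptsThrough {m : ℕ} (a : Fin m → Fin 2 → ℤ)
    (t : SpanningTriple a) (x : Fin 2 → UnitAddCircle) :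
    ∑ l, extendedNormal a t l • interceptsThrough a x l = 0 := by
  rw [sum_extendedNormal_smul, tripleNormal_eq]
  exact sum_smul_sum_smul (sum_primitivePart_columnCross_mul (columnCross_ne_zero t.2)) x

/-- Translating the whole arrangement along a straight path changes no pairing of the intercepts
with an extended normal, so no triple point arises on the way. -/
theorem joinedIn_noTriple_add {m : ℕ} {a : Fin m → Fin 2 → ℤ} (ha : ∀ i, a i ≠ 0) {g h : Fin m}
    (hgh : det₂ (a g) (a h) ≠ 0) {b : Fin m → UnitAddCircle} (hb : NoTriple a b)
    (x : Fin 2 → UnitAddCircle) :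
    JoinedIn {b | NoTriple a b} b (b + interceptsThrough a x) := by
  obtain ⟨y, rfl⟩ := isOpenQuotientMap_torusProj.surjective x
  have hcont : Continuous fun s : ℝ => b + interceptsThrough a (torusProj (s • y)) := by
    have h (s : ℝ) : interceptsThrough a (torusProj (s • y)) =
        torusProj fun i => s * realPairing (a i) y := by
      funext i
      rw [interceptsThrough, ← coe_realPairing, map_smul, smul_eq_mul]
      rfl
    simp only [h]
    exact continuous_const.add (isOpenQuotientMap_torusProj.continuous.comp (by fun_prop))
  refine JoinedIn.ofLine hcont.continuousOn ?_ (by simp) ?_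
  · funext i
    simp [interceptsThrough, ← coe_realPairing]
  · rintro _ ⟨s, -, rfl⟩
    refine (noTriple_iff ha hgh).2 fun t => ?_
    simp only [Pi.add_apply, smul_add, Finset.sum_add_distrib,
      sum_extendedNormal_smul_interceptsThrough, add_zero]
    exact (noTriple_iff ha hgh).1 hb t

/-- The vector of intercepts with value `0` at `g` and `h` and prescribed values elsewhere. -/
def extendIntercepts {m : ℕ} (g h : Fin m) (p : OtherIndex g h → UnitAddCircle) :
    Fin m → UnitAddCircle :=
  fun l => if hl : l ≠ g ∧ l ≠ h then p ⟨l, hl⟩ else 0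

theorem continuous_extendIntercepts {m : ℕ} (g h : Fin m) :
    Continuous (extendIntercepts g h) := by
  refine continuous_pi fun l => ?_
  unfold extendIntercepts
  split_ifs
  · exact continuous_apply _
  · exact continuous_const

theorem extendIntercepts_restrict {m : ℕ} {g h : Fin m} {b : Fin m → UnitAddCircle}
    (hg : b g = 0) (hh : b h = 0) :
    extendIntercepts g h (fun l => b l.1) = b := by
  funext l
  unfold extendIntercepts
  split_ifs with hl
  · rfl
  · rcases not_and_or.1 hl with h' | h' <;> rw [not_not.1 h'] <;> simp [hg, hh]

theorem extendIntercepts_add {m : ℕ} (g h : Fin m) (p q : OtherIndex g h → UnitAddCircle) :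
    extendIntercepts g h (p + q) = extendIntercepts g h p + extendIntercepts g h q := by
  funext l
  simp only [extendIntercepts, Pi.add_apply]
  split_ifs <;> simp

theorem sum_reducedNormal_smul {m : ℕ} (a : Fin m → Fin 2 → ℤ) (g h : Fin m)
    (t : SpanningTriple a) (p : OtherIndex g h → UnitAddCircle) :
    ∑ l, reducedNormal a g h t l • p l = ∑ l, extendedNormal a t l • extendIntercepts g h p l := by
  refine Fintype.sum_of_injective Subtype.val Subtype.val_injective _ _ (fun l hl => ?_)
    fun l => ?_
  · have : ¬ (l ≠ g ∧ l ≠ h) := fun h' => hl ⟨⟨l, h'⟩, rfl⟩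
    simp [extendIntercepts, dif_neg this]
  · simp [extendIntercepts, dif_pos l.2, reducedNormal]

theorem mem_toricComplement_iff_noTriple {m : ℕ} {a : Fin m → Fin 2 → ℤ} (ha : ∀ i, a i ≠ 0)
    {g h : Fin m} (hgh : det₂ (a g) (a h) ≠ 0) {p : OtherIndex g h → UnitAddCircle} :
    p ∈ toricComplement (reducedNormal a g h) ↔ NoTriple a (extendIntercepts g h p) := by
  rw [mem_toricComplement, noTriple_iff ha hgh]
  simp only [sum_reducedNormal_smul]

theorem ne_of_det₂_ne_zero {m : ℕ} {a : Fin m → Fin 2 → ℤ} {g h : Fin m}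
    (hgh : det₂ (a g) (a h) ≠ 0) : g ≠ h := by
  rintro rfl
  exact hgh (by rw [det₂_eq]; ring)

theorem extendedNormal_ne_zero {m : ℕ} {a : Fin m → Fin 2 → ℤ} {g h l : Fin m}
    (hgh : det₂ (a g) (a h) ≠ 0) (hgl : g ≠ l) (hhl : h ≠ l) {t : SpanningTriple a}
    (ht : Set.range t.1 = {g, h, l}) : extendedNormal a t l ≠ 0 := by
  obtain ⟨r, rfl⟩ : g ∈ Set.range t.1 := by simp [ht]
  obtain ⟨r', rfl⟩ : h ∈ Set.range t.1 := by simp [ht]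
  obtain ⟨s, rfl⟩ : l ∈ Set.range t.1 := by simp [ht]
  rw [extendedNormal, t.1.injective.extend_apply, tripleNormal_eq]
  intro h0
  refine hgh (det₂_eq_zero_of_columnCross_eq_zero (A := fun s => a (t.1 s)) (s := s) ?_
    (ne_of_apply_ne t.1 hgl) (ne_of_apply_ne t.1 hhl))
  exact (gcd_mul_primitivePart _ s).symm.trans (by rw [h0, mul_zero])

/-- For each remaining index `l`, the triple formed by `g`, `h`, `l` has a reduced normal supported
at `l` alone, where its entry is a nonzero multiple of a coordinate vector's. -/
theorem reducedNormal_essential {m : ℕ} {a : Fin m → Fin 2 → ℤ} {g h : Fin m}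
    (hgh : det₂ (a g) (a h) ≠ 0) (d : OtherIndex g h → ℝ)
    (hd : ∀ t, realPairing (reducedNormal a g h t) d = 0) : d = 0 := by
  funext l
  obtain ⟨t, ht⟩ := exists_spanningTriple (ne_of_det₂_ne_zero hgh) l.2.1.symm l.2.2.symm hgh
  have h1 := hd t
  rw [realPairing_apply, Finset.sum_eq_single l] at h1
  · have h0 : reducedNormal a g h t l ≠ 0 :=
      extendedNormal_ne_zero hgh l.2.1.symm l.2.2.symm ht
    exact (mul_eq_zero.1 h1).resolve_left (by exact_mod_cast h0)
  · intro k _ hkl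
    have hk : (k : Fin m) ∉ Set.range t.1 := by
      rw [ht]
      rintro (h' | h' | h')
      exacts [k.2.1 h', k.2.2 h', hkl (Subtype.ext h')]
    rw [reducedNormal, extendedNormal, Function.extend_apply' _ _ _ (by simpa using hk)]
    simp
  · simp

/-! ### Flats of the parameter arrangement and classes of line arrangements -/

/-- The class of arrangements that corresponds to a flat of the parameter arrangement. -/
def classOfFlat {m : ℕ} {a : Fin m → Fin 2 → ℤ} (ha : ∀ i, a i ≠ 0) {g h : Fin m}
    (hgh : det₂ (a g) (a h) ≠ 0) (C : ParameterFlats a g h) : ArrangementClass a :=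
  Quotient.mk _ ⟨extendIntercepts g h (Quotient.out C).1,
    (mem_toricComplement_iff_noTriple ha hgh).1 (Quotient.out C).2⟩

/-- Independence of the chosen representative: points of one connected component are joined by a
path in the complement, and extending by zeros turns it into an admissible translation. -/
theorem classOfFlat_mk {m : ℕ} {a : Fin m → Fin 2 → ℤ} (ha : ∀ i, a i ≠ 0) {g h : Fin m}
    (hgh : det₂ (a g) (a h) ≠ 0) (p : toricComplement (reducedNormal a g h)) :
    classOfFlat ha hgh (p : ConnectedComponents (toricComplement (reducedNormal a g h))) =
      Quotient.mk _ ⟨extendIntercepts g h p.1,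
        (mem_toricComplement_iff_noTriple ha hgh).1 p.2⟩ := by
  set q : toricComplement (reducedNormal a g h) := Quotient.out (ConnectedComponents.mk p)
  have hqp : ConnectedComponents.mk q = ConnectedComponents.mk p :=
    Quotient.out_eq (ConnectedComponents.mk p)
  obtain ⟨x, hx⟩ := isOpenQuotientMap_torusProj.surjective q.1
  obtain ⟨y, hy⟩ := isOpenQuotientMap_torusProj.surjective p.1
  have hj := (sameCell_of_mk_eq hqp hx hy).joinedIn (hx ▸ q.2) (hy ▸ p.2)
  rw [hx, hy] at hj
  refine Quotient.sound ?_
  change JoinedIn {b | NoTriple a b} (extendIntercepts g h q.1) (extendIntercepts g h p.1)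
  refine (hj.map (continuous_extendIntercepts g h)).mono ?_
  rintro _ ⟨r, hr, rfl⟩
  exact (mem_toricComplement_iff_noTriple ha hgh).1 hr

theorem classOfFlat_surjective {m : ℕ} {a : Fin m → Fin 2 → ℤ} (ha : ∀ i, a i ≠ 0) {g h : Fin m}
    (hgh : det₂ (a g) (a h) ≠ 0) : Function.Surjective (classOfFlat ha hgh) := by
  intro B
  obtain ⟨b, rfl⟩ := Quotient.exists_rep B
  obtain ⟨β, hβ⟩ := isOpenQuotientMap_torusProj.surjective b.1
  -- The translation that brings lines `g` and `h` to the origin.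
  obtain ⟨y, hyg, hyh⟩ := exists_realPairing_eq_pair hgh (-β g) (-β h)
  have hj := joinedIn_noTriple_add ha hgh b.2 (torusProj y)
  set b' := b.1 + interceptsThrough a (torusProj y) with hb'
  have hzero (i : Fin m) (hi : realPairing (a i) y = -β i) : b' i = 0 := by
    rw [hb', ← hβ, Pi.add_apply, interceptsThrough, ← coe_realPairing, hi]
    simp [torusProj]
  have hext := extendIntercepts_restrict (hzero g hyg) (hzero h hyh)
  have hmem : (fun l => b' l.1) ∈ toricComplement (reducedNormal a g h) :=
    (mem_toricComplement_iff_noTriple ha hgh).2 (by rw [hext]; exact hj.target_mem)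
  refine ⟨((⟨_, hmem⟩ : toricComplement (reducedNormal a g h)) :
    ConnectedComponents (toricComplement (reducedNormal a g h))), ?_⟩
  rw [classOfFlat_mk]
  refine Quotient.sound ?_
  change JoinedIn {b | NoTriple a b} (extendIntercepts g h fun l => b' l.1) b.1
  rw [hext]
  exact hj.symm

/-- The points common to the lines through the origin with normals `a g` and `a h` act freely,
modulo the points common to all the lines, on the flats that correspond to a given class. -/
theorem card_classes_mul_card_le {m : ℕ} {a : Fin m → Fin 2 → ℤ} (ha : ∀ i, a i ≠ 0)
    {g h : Fin m} (hgh : det₂ (a g) (a h) ≠ 0)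
    [Finite (torusAnnihilator (AddSubgroup.closure (Set.range ![a g, a h])))]
    [Finite (torusAnnihilator (AddSubgroup.closure (Set.range a)))] :
    Nat.card (ArrangementClass a) *
        Nat.card (torusAnnihilator (AddSubgroup.closure (Set.range ![a g, a h]))) ≤
      Nat.card (torusAnnihilator (AddSubgroup.closure (Set.range a))) *
        Nat.card (ParameterFlats a g h) := by
  set K := torusAnnihilator (AddSubgroup.closure (Set.range ![a g, a h])) with hK
  set K₀ := torusAnnihilator (AddSubgroup.closure (Set.range a)) with hK₀
  have hess := reducedNormal_essential hgh
  have hfin : Finite (ParameterFlats a g h) := finite_topFlats hess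
  have hfin' := Finite.of_surjective _ (classOfFlat_surjective ha hgh)
  have hKg (x : K) : interceptsThrough a x.1 g = 0 :=
    mem_torusAnnihilator_closure.1 x.2 _ ⟨0, rfl⟩
  have hKh (x : K) : interceptsThrough a x.1 h = 0 :=
    mem_torusAnnihilator_closure.1 x.2 _ ⟨1, rfl⟩
  set σ : K → OtherIndex g h → UnitAddCircle := fun x l => interceptsThrough a x.1 l.1 with hσ
  have hσe (x : K) : extendIntercepts g h (σ x) = interceptsThrough a x.1 :=
    extendIntercepts_restrict (hKg x) (hKh x)
  have hσ0 (x : K) (t) : ∑ l, reducedNormal a g h t l • σ x l = 0 := by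
    rw [sum_reducedNormal_smul, hσe, sum_extendedNormal_smul_interceptsThrough]
  choose F hF using classOfFlat_surjective ha hgh
  choose p hp using fun B => ConnectedComponents.surjective_coe (F B)
  have hmem (B : ArrangementClass a) (x : K) :
      (p B).1 + σ x ∈ toricComplement (reducedNormal a g h) := by
    rw [mem_toricComplement]
    intro t
    simp only [Pi.add_apply, smul_add, Finset.sum_add_distrib, hσ0, add_zero]
    exact mem_toricComplement.1 (p B).2 t
  -- Choose one flat in each class and move it by all points of `K`. The moved flats stay in the
  -- class.
  set ψ : ArrangementClass a × K → ParameterFlats a g h := fun Bx =>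
    ((⟨_, hmem Bx.1 Bx.2⟩ : toricComplement (reducedNormal a g h)) :
      ConnectedComponents (toricComplement (reducedNormal a g h))) with hψ
  have hψ1 (Bx : ArrangementClass a × K) : classOfFlat ha hgh (ψ Bx) = Bx.1 := by
    have hB := (classOfFlat_mk ha hgh (p Bx.1)).symm.trans
      ((congrArg (classOfFlat ha hgh) (hp Bx.1)).trans (hF Bx.1))
    refine (classOfFlat_mk ha hgh ⟨_, hmem Bx.1 Bx.2⟩).trans (Eq.trans (Quotient.sound ?_) hB)
    change JoinedIn {b | NoTriple a b} (extendIntercepts g h ((p Bx.1).1 + σ Bx.2))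
      (extendIntercepts g h (p Bx.1).1)
    have := joinedIn_noTriple_add ha hgh
      ((mem_toricComplement_iff_noTriple ha hgh).1 (p Bx.1).2) Bx.2.1
    rw [← hσe, ← extendIntercepts_add] at this
    exact this.symm
  have hψ2 (B : ArrangementClass a) (x y : K) (hxy : ψ (B, x) = ψ (B, y)) : x.1 - y.1 ∈ K₀ := by
    have := eq_of_mk_add_eq hess (hσ0 x) (hσ0 y) (hmem B x) (hmem B y) hxy
    have hi : interceptsThrough a x.1 = interceptsThrough a y.1 := by rw [← hσe, this, hσe]
    refine mem_torusAnnihilator_closure.2 ?_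
    rintro _ ⟨i, rfl⟩
    simp only [Pi.sub_apply, smul_sub, Finset.sum_sub_distrib]
    exact sub_eq_zero.2 (congrFun hi i)
  have := Fintype.ofFinite (ArrangementClass a)
  have := Fintype.ofFinite (ParameterFlats a g h)
  have := Fintype.ofFinite K
  have := Fintype.ofFinite K₀
  simp only [Nat.card_eq_fintype_card]
  rw [← Fintype.card_prod, ← Finset.card_univ, ← Finset.card_univ (α := ParameterFlats a g h)]
  -- Each fibre of `ψ` involves a single class, and subtracting one fixed translation embeds it into
  -- `K₀`.
  refine Finset.card_le_mul_card_image_of_maps_to (f := ψ) (fun _ _ => Finset.mem_univ _) _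
    fun C _ => ?_
  rcases Finset.eq_empty_or_nonempty {Bx | ψ Bx = C} with h' | ⟨⟨B, x⟩, hx⟩
  · rw [h']
    simp
  · have hx : ψ (B, x) = C := by simpa using hx
    rw [← Fintype.card_subtype]
    have hB (Bx : {Bx // ψ Bx = C}) : Bx.1.1 = B := by
      rw [← hψ1 Bx.1, Bx.2, ← hx, hψ1]
    have hC (Bx : {Bx // ψ Bx = C}) : Bx.1.2.1 - x.1 ∈ K₀ := by
      refine hψ2 B _ _ ?_
      rw [hx, ← hB Bx]
      exact Bx.2
    refine Fintype.card_le_of_injective (fun Bx : {Bx // ψ Bx = C} => (⟨_, hC Bx⟩ : K₀))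
      fun Bx By hBB => ?_
    refine Subtype.ext (Prod.ext ((hB Bx).trans (hB By).symm) (Subtype.ext ?_))
    exact sub_left_injective (congrArg Subtype.val hBB)

theorem card_otherIndex {m : ℕ} {g h : Fin m} (hgh : g ≠ h) :
    Fintype.card (OtherIndex g h) = m - 2 := by
  rw [Fintype.card_subtype]
  have : ({l | l ≠ g ∧ l ≠ h} : Finset (Fin m)) = ({g, h} : Finset (Fin m))ᶜ := by
    ext l
    simp
  rw [this, Finset.card_compl, Finset.card_pair hgh, Fintype.card_fin]

end

/-! ### Assembling the bounds -/

theorem mainTheorem6 (m : ℕ) (hm : 3 < m) (a : Fin m → Fin 2 → ℤ) (ha : ∀ i, a i ≠ 0)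
    (g h : Fin m) (hgh : det₂ (a g) (a h) ≠ 0)
    (hmin : ∀ i j : Fin m, det₂ (a i) (a j) ≠ 0 → |det₂ (a g) (a h)| ≤ |det₂ (a i) (a j)|) :
    Finite (ArrangementClass a) ∧ Finite (ParameterFlats a g h) ∧
    Nat.card (ArrangementClass a) ≤ Nat.card (ParameterFlats a g h) ∧
    (Nat.card (ParameterFlats a g h) : ℤ) ≤ determinantSum a g h ∧
    (Nat.card (ArrangementClass a) : ℚ) ≤
      ((AddSubgroup.closure (Set.range a)).index : ℚ) / |(det₂ (a g) (a h) : ℚ)| *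
        Nat.card (ParameterFlats a g h) ∧
    (Nat.card (ArrangementClass a) : ℚ) ≤
      ((AddSubgroup.closure (Set.range a)).index : ℚ) / |(det₂ (a g) (a h) : ℚ)| *
        determinantSum a g h ∧
    (AddSubgroup.closure (Set.range a) = ⊤ →
      (Nat.card (ArrangementClass a) : ℚ) ≤
          1 / |(det₂ (a g) (a h) : ℚ)| * Nat.card (ParameterFlats a g h) ∧
      (Nat.card (ArrangementClass a) : ℚ) ≤
          1 / |(det₂ (a g) (a h) : ℚ)| * determinantSum a g h) := by
  have hess := reducedNormal_essential hgh
  have hfin : Finite (ParameterFlats a g h) := finite_topFlats hess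
  have hsurj := classOfFlat_surjective ha hgh
  have hfin' := Finite.of_surjective _ hsurj
  have hfS : (Nat.card (ParameterFlats a g h) : ℤ) ≤ determinantSum a g h := by
    have := card_topFlats_le hess
    rwa [card_otherIndex (ne_of_det₂_ne_zero hgh)] at this
  have hidx : (AddSubgroup.closure (Set.range ![a g, a h])).index =
      (det₂ (a g) (a h)).natAbs := index_closure_range_eq_natAbs_det (Matrix.of ![a g, a h]) hgh
  have hfi : (AddSubgroup.closure (Set.range ![a g, a h])).FiniteIndex :=
    ⟨by rw [hidx]; simpa using hgh⟩
  have hle : AddSubgroup.closure (Set.range ![a g, a h]) ≤ AddSubgroup.closure (Set.range a) := by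
    refine AddSubgroup.closure_mono ?_
    rintro _ ⟨s, rfl⟩
    fin_cases s
    exacts [⟨g, rfl⟩, ⟨h, rfl⟩]
  have hfi' : (AddSubgroup.closure (Set.range a)).FiniteIndex :=
    AddSubgroup.finiteIndex_of_le hle
  have := finite_torusAnnihilator (AddSubgroup.closure (Set.range ![a g, a h]))
  have := finite_torusAnnihilator (AddSubgroup.closure (Set.range a))
  have hmul := card_classes_mul_card_le ha hgh
  -- By duality the two annihilators have orders D and e, so `hmul` becomes N·D ≤ e·f.
  rw [card_torusAnnihilator, card_torusAnnihilator, hidx] at hmul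
  have hD : (0 : ℚ) < |(det₂ (a g) (a h) : ℚ)| := abs_pos.2 (by exact_mod_cast hgh)
  have hNf : (Nat.card (ArrangementClass a) : ℚ) ≤
      ((AddSubgroup.closure (Set.range a)).index : ℚ) / |(det₂ (a g) (a h) : ℚ)| *
        Nat.card (ParameterFlats a g h) := by
    rw [div_mul_eq_mul_div, le_div_iff₀ hD, ← Int.cast_abs, Int.abs_eq_natAbs]
    exact_mod_cast hmul
  have hfS' : (Nat.card (ParameterFlats a g h) : ℚ) ≤ determinantSum a g h := by
    exact_mod_cast hfS
  have hNS := hNf.trans (mul_le_mul_of_nonneg_left hfS' (by positivity))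
  refine ⟨hfin', hfin, Nat.card_le_card_of_surjective _ hsurj, hfS, hNf, hNS, fun htop => ?_⟩
  rw [htop, AddSubgroup.index_top, Nat.cast_one] at hNf hNS
  exact ⟨hNf, hNS⟩
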